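/- Conventions. A cartesian category is a category with chosen finite products $\times$ and terminal object $1$, viewed as a symmetric monoidal category; a cartesian functor between cartesian categories is a strong symmetric monoidal functor, i.e. one that preserves finite products. $\mathrm{Ab}(\mathcal C)$ is the category of abelian group objects, $\mathrm{Ring}(\mathcal C)$ that of (unital, associative, not necessarily commutative) ring objects, $\mathrm{GrAb}(\mathcal C)$ that of sequences $(A_n)_{n\ge 0}$ of abelian group objects, and $\mathrm{GrRing}(\mathcal C)$ that of graded ring objects: sequences $(A_n)_{n\ge 0}$ in $\mathrm{Ab}(\mathcal C)$ with a unit $1\to A_0$ and multiplications $A_n\times A_m\to A_{n+m}$ that are associative, unital and distributive in each variable; morphisms are degreewise homomorphisms that respect unit and multiplications. Let $\mathcal C$ be a cocomplete, cartesian closed category and let $F:s\mathbf{Set}\to\mathcal C$ be a cartesian functor that is a left adjoint. For a simplicial object $X$ of $\mathcal C$ put $|X|=\int^{n} X_n\times F\Delta^n$. The functor $|-|$ is cartesian, and $|cA|\cong A$ for the constant simplicial object $cA$. For $A\in \mathrm{Ab}(\mathcal C)$ let $B_\bullet A$ be the simplicial abelian group object with $B_pA=A^p$, whose first and last faces drop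 the first and the last coordinate, whose other faces add adjacent coordinates, and whose degeneracies insert $0$. Put $BA=|B_\bullet A|\in\mathrm{Ab}(\mathcal C)$, $B^0=\mathrm{id}$, $B^{n+1}=B\circ B^n$ and $B^*A=(B^nA)_{n\ge 0}\in \mathrm{GrAb}(\mathcal C)$. **Theorem.** a) The functor $B^*$ extends to a functor $B^*:\mathrm{Ring}(\mathcal C)\to\mathrm{GrRing}(\mathcal C)$: for every ring object $S$ with multiplication $\mu$ there is a graded ring structure on $B^*S$, natural in $S$, whose unit is the unit of $S$ and whose multiplications $\smile_{n,m}:B^nS\times B^mS\to B^{n+m}S$ are determined inductively as follows. - $\smile_{0,0}=\mu$. - The morphisms $\varphi^p: S\times (B^mS)^p\to (B^mS)^p$, $(s,(x_i)_i)\mapsto (s\smile_{0,m}x_i)_i$, form a simplicial morphism $\varphi: cS\times B_\bullet B^mS\to B_\bullet B^mS$, and $\smile_{0,m+1}$ is the composite $S\times B^{m+1}S\cong |cS\times B_\bullet B^mS|\xrightarrow{|\varphi|}B^{m+1}S$. - For all $n,m\ge 0$ the morphisms $(B^nS)^p\times B^mS\to (B^{n+m}S)^p$, $((x_i)_i,y)\mapsto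 (x_i\smile_{n,m}y)_i$, form a simplicial morphism $\psi: B_\bullet B^nS\times c(B^mS)\to B_\bullet B^{n+m}S$, and $\smile_{n+1,m}$ is the composite $B^{n+1}S\times B^mS\cong |B_\bullet B^nS\times c(B^mS)|\xrightarrow{|\psi|}B^{n+m+1}S$. b) Let $\mathcal D$ be a cocomplete, cartesian closed category and let $G:\mathcal C\to\mathcal D$ be a cartesian functor that is a left adjoint. Form the bar constructions and the functor $B^*:\mathrm{Ring}(\mathcal D)\to\mathrm{GrRing}(\mathcal D)$ of a) in $\mathcal D$ with respect to $GF:s\mathbf{Set}\to\mathcal D$. Then there is a natural isomorphism $B^*\circ G\cong G\circ B^*$ of functors $\mathrm{Ring}(\mathcal C)\to\mathrm{GrRing}(\mathcal D)$. -/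

import Mathlib

/-!
The iterated bar constructions of ring objects in a cartesian category.
-/

open CategoryTheory MonoidalCategory CartesianMonoidalCategory Opposite
open Limits (HasColimits coend coendFunctor)
universe v v' u u'
set_option linter.unusedSectionVars false
noncomputable section
namespace BarConstruction
section General
variable {C : Type u} [Category.{v} C] [CartesianMonoidalCategory C]

/-- The bifunctor `([n], [m]) ↦ X_n × D^m`, functorially in the simplicial object `X`. -/
def realizationBifunctor (D : SimplexCategory ⥤ C) :
    (SimplexCategoryᵒᵖ ⥤ C) ⥤ (SimplexCategoryᵒᵖ ⥤ SimplexCategory ⥤ C) :=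
  (Functor.whiskeringRight _ _ _).obj
    (curriedTensor C ⋙ (Functor.whiskeringLeft _ _ C).obj (D))

variable [HasColimits C]

/-- The geometric realization `|X|`, the coend `∫^n X_n × D^n`, for a cosimplicial object `D`. -/
def realization (D : SimplexCategory ⥤ C) : (SimplexCategoryᵒᵖ ⥤ C) ⥤ C :=
  realizationBifunctor D ⋙ coendFunctor SimplexCategory C

variable (D : SimplexCategory ⥤ C)

/-- The structural morphisms `X_n × D^n ⟶ |X|`. -/
def realizationι (X : SimplexCategoryᵒᵖ ⥤ C) (n : SimplexCategory) :
    X.obj (op n) ⊗ D.obj n ⟶ (realization D).obj X :=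
  coend.ι ((realizationBifunctor D).obj X) n

variable {D}

lemma realizationι_map {X Y : SimplexCategoryᵒᵖ ⥤ C} (f : X ⟶ Y) (n : SimplexCategory) :
    realizationι D X n ≫ (realization D).map f =
      f.app (op n) ▷ D.obj n ≫ realizationι D Y n :=
  coend.ι_map _ _

lemma realizationι_condition (X : SimplexCategoryᵒᵖ ⥤ C) {n m : SimplexCategory} (a : n ⟶ m) :
    X.map a.op ▷ D.obj n ≫ realizationι D X n =
      X.obj (op m) ◁ D.map a ≫ realizationι D X m :=
  coend.condition ((realizationBifunctor D).obj X) a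

lemma realization_hom_ext {X : SimplexCategoryᵒᵖ ⥤ C} {T : C} {f g : (realization D).obj X ⟶ T}
    (h : ∀ n, realizationι D X n ≫ f = realizationι D X n ≫ g) : f = g :=
  coend.hom_ext h

/-- The universal property of the realization. -/
def realizationDesc {X : SimplexCategoryᵒᵖ ⥤ C} {T : C}
    (f : ∀ n : SimplexCategory, X.obj (op n) ⊗ D.obj n ⟶ T)
    (hf : ∀ {n m : SimplexCategory} (a : n ⟶ m), X.map a.op ▷ _ ≫ f n =
      X.obj (op m) ◁ D.map a ≫ f m) :
    (realization D).obj X ⟶ T :=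
  coend.desc (F := (realizationBifunctor D).obj X) f (fun _ _ a ↦ hf a)

lemma realizationι_desc {X : SimplexCategoryᵒᵖ ⥤ C} {T : C}
    (f : ∀ n : SimplexCategory, X.obj (op n) ⊗ D.obj n ⟶ T)
    (hf : ∀ {n m : SimplexCategory} (a : n ⟶ m), X.map a.op ▷ _ ≫ f n =
      X.obj (op m) ◁ D.map a ≫ f m) (n : SimplexCategory) :
    realizationι D X n ≫ realizationDesc f hf = f n :=
  coend.ι_desc (F := (realizationBifunctor D).obj X) _ _ _

section Closed
variable [MonoidalClosed C]

lemma whiskerLeft_realization_hom_ext {W : C} {X : SimplexCategoryᵒᵖ ⥤ C} {T : C}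
    {f g : W ⊗ (realization D).obj X ⟶ T}
    (h : ∀ n, W ◁ realizationι D X n ≫ f = W ◁ realizationι D X n ≫ g) : f = g := by
  apply MonoidalClosed.curry_injective
  apply realization_hom_ext
  intro n
  rw [← MonoidalClosed.curry_natural_left, ← MonoidalClosed.curry_natural_left, h]

lemma exists_whiskerLeft_desc {W : C} {X : SimplexCategoryᵒᵖ ⥤ C} {T : C}
    (f : ∀ n : SimplexCategory, W ⊗ (X.obj (op n) ⊗ D.obj n) ⟶ T)
    (hf : ∀ {n m : SimplexCategory} (a : n ⟶ m), W ◁ (X.map a.op ▷ _) ≫ f n =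
      W ◁ (X.obj (op m) ◁ D.map a) ≫ f m) :
    ∃ g : W ⊗ (realization D).obj X ⟶ T, ∀ n, W ◁ realizationι D X n ≫ g = f n := by
  refine ⟨MonoidalClosed.uncurry (realizationDesc (fun n ↦ MonoidalClosed.curry (f n)) ?_), ?_⟩
  · intro n m a
    rw [← MonoidalClosed.curry_natural_left, ← MonoidalClosed.curry_natural_left, hf]
  · intro n
    rw [← MonoidalClosed.uncurry_natural_left, realizationι_desc, MonoidalClosed.uncurry_curry]

variable [BraidedCategory C]

lemma whiskerRight_realization_hom_ext {W : C} {X : SimplexCategoryᵒᵖ ⥤ C} {T : C}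
    {f g : (realization D).obj X ⊗ W ⟶ T}
    (h : ∀ n, realizationι D X n ▷ W ≫ f = realizationι D X n ▷ W ≫ g) : f = g := by
  rw [← cancel_epi (β_ _ _).hom]
  apply whiskerLeft_realization_hom_ext
  intro n
  simp [h]

lemma exists_whiskerRight_desc {W : C} {X : SimplexCategoryᵒᵖ ⥤ C} {T : C}
    (f : ∀ n : SimplexCategory, (X.obj (op n) ⊗ D.obj n) ⊗ W ⟶ T)
    (hf : ∀ {n m : SimplexCategory} (a : n ⟶ m), (X.map a.op ▷ _) ▷ W ≫ f n =
      (X.obj (op m) ◁ D.map a) ▷ W ≫ f m) :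
    ∃ g : (realization D).obj X ⊗ W ⟶ T, ∀ n, realizationι D X n ▷ W ≫ g = f n := by
  obtain ⟨g, hg⟩ := exists_whiskerLeft_desc (D := D) (W := W) (X := X)
    (fun n ↦ (β_ _ _).hom ≫ f n) (fun a ↦ by
      rw [BraidedCategory.braiding_naturality_right_assoc,
        BraidedCategory.braiding_naturality_right_assoc, hf])
  exact ⟨(β_ _ _).inv ≫ g, fun n ↦ by
    rw [BraidedCategory.braiding_inv_naturality_left_assoc, hg, Iso.inv_hom_id_assoc]⟩

/-- The morphism `(W₁ × W₂) × D^i ⟶ (W₁ × D^n) × (W₂ × D^m)`,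
`(x, y, t) ↦ ((x, a t), (y, b t))`. -/
def probe (D : SimplexCategory ⥤ C) (W₁ W₂ : C) {i n m : SimplexCategory} (a : i ⟶ n) (b : i ⟶ m) :
    (W₁ ⊗ W₂) ⊗ D.obj i ⟶
      (W₁ ⊗ D.obj n) ⊗ (W₂ ⊗ D.obj m) :=
  lift (lift (fst _ _ ≫ fst _ _) (snd _ _ ≫ D.map a))
    (lift (fst _ _ ≫ snd _ _) (snd _ _ ≫ D.map b))

lemma probe_naturality_left {W₁ W₁' W₂ : C} (f : W₁ ⟶ W₁') {i n m : SimplexCategory}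
    (a : i ⟶ n) (b : i ⟶ m) :
    probe D W₁ W₂ a b ≫ (f ▷ _) ▷ _ = (f ▷ _) ▷ _ ≫ probe D W₁' W₂ a b := by
  ext <;> simp [probe]

lemma probe_naturality_right {W₁ W₂ W₂' : C} (f : W₂ ⟶ W₂') {i n m : SimplexCategory}
    (a : i ⟶ n) (b : i ⟶ m) :
    probe D W₁ W₂ a b ≫ _ ◁ (f ▷ _) = (_ ◁ f) ▷ _ ≫ probe D W₁ W₂' a b := by
  ext <;> simp [probe]

lemma probe_comp_left (W₁ W₂ : C) {i n n' m : SimplexCategory}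
    (a : i ⟶ n) (c : n ⟶ n') (b : i ⟶ m) :
    probe D W₁ W₂ a b ≫ (_ ◁ D.map c) ▷ _ = probe D W₁ W₂ (a ≫ c) b := by
  ext <;> simp [probe]

lemma probe_comp_right (W₁ W₂ : C) {i n m' m : SimplexCategory}
    (a : i ⟶ n) (c : m ⟶ m') (b : i ⟶ m) :
    probe D W₁ W₂ a b ≫ _ ◁ (_ ◁ D.map c) = probe D W₁ W₂ a (b ≫ c) := by
  ext <;> simp [probe]

lemma probe_precomp (W₁ W₂ : C) {i j n m : SimplexCategory}
    (c : i ⟶ j) (a : j ⟶ n) (b : j ⟶ m) :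
    _ ◁ D.map c ≫ probe D W₁ W₂ a b = probe D W₁ W₂ (c ≫ a) (c ≫ b) := by
  ext <;> simp [probe]

lemma exists_tensor_realization_desc {X Y : SimplexCategoryᵒᵖ ⥤ C} {T : C}
    (f : ∀ n m : SimplexCategory, (X.obj (op n) ⊗ D.obj n) ⊗
      (Y.obj (op m) ⊗ D.obj m) ⟶ T)
    (hf₁ : ∀ {n n' : SimplexCategory} (c : n ⟶ n') (m : SimplexCategory),
      (X.map c.op ▷ _) ▷ _ ≫ f n m =
        (X.obj (op n') ◁ D.map c) ▷ _ ≫ f n' m)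
    (hf₂ : ∀ (n : SimplexCategory) {m m' : SimplexCategory} (c : m ⟶ m'),
      _ ◁ (Y.map c.op ▷ _) ≫ f n m =
        _ ◁ (Y.obj (op m') ◁ D.map c) ≫ f n m') :
    ∃ g : (realization D).obj X ⊗ (realization D).obj Y ⟶ T,
      ∀ n m, (realizationι D X n ⊗ₘ realizationι D Y m) ≫ g = f n m := by
  choose g hg using fun n ↦ exists_whiskerLeft_desc (D := D) (f n) (hf₂ n)
  obtain ⟨h, hh⟩ := exists_whiskerRight_desc (D := D) (X := X) g (by
    intro n m a
    apply whiskerLeft_realization_hom_ext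
    intro k
    rw [whisker_exchange_assoc, whisker_exchange_assoc, hg, hg, hf₁])
  refine ⟨h, fun n m ↦ ?_⟩
  rw [tensorHom_def', Category.assoc, hh, hg]

lemma tensor_realization_hom_ext {X Y : SimplexCategoryᵒᵖ ⥤ C} {T : C}
    {f g : (realization D).obj X ⊗ (realization D).obj Y ⟶ T}
    (h : ∀ n m, (realizationι D X n ⊗ₘ realizationι D Y m) ≫ f =
      (realizationι D X n ⊗ₘ realizationι D Y m) ≫ g) : f = g := by
  apply whiskerRight_realization_hom_ext
  intro n
  apply whiskerLeft_realization_hom_ext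
  intro m
  simpa only [tensorHom_def', Category.assoc] using h n m

end Closed
end General

section Standard

variable {C : Type u} [Category.{v} C]

/-- The Yoneda embedding `[n] ↦ Δ^n`. -/
def standardSimplex : SimplexCategory ⥤ SSet.{v} := SSet.stdSimplex

/-- The cosimplicial object `[n] ↦ F Δ^n`. -/
def cosimplicialObject (F : SSet.{v} ⥤ C) : SimplexCategory ⥤ C :=
  standardSimplex ⋙ F

/-- The Yoneda lemma for simplicial sets. -/
def yonedaEquiv {P : SSet.{v}} {n : SimplexCategory} :
    (standardSimplex.obj n ⟶ P) ≃ P.obj (op n) :=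
  SSet.yonedaEquiv

lemma sset_hom_ext {P Q : SSet.{v}} {f g : P ⟶ Q}
    (h : ∀ (i : SimplexCategory) (p : standardSimplex.obj i ⟶ P), p ≫ f = p ≫ g) : f = g := by
  ext ⟨i⟩ p
  obtain ⟨p, rfl⟩ := yonedaEquiv.surjective p
  exact congr_arg yonedaEquiv (h i p)

lemma yonedaEquiv_naturality {P : SSet.{v}} {i j : SimplexCategory}
    (c : op i ⟶ op j) (p : standardSimplex.obj i ⟶ P) :
    P.map c (yonedaEquiv p) = yonedaEquiv (standardSimplex.map c.unop ≫ p) :=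
  uliftYonedaEquiv_naturality _ _

lemma exists_eq_lift {i n m : SimplexCategory}
    (p : standardSimplex.{v}.obj i ⟶ standardSimplex.obj n ⊗ standardSimplex.obj m) :
    ∃ (a : i ⟶ n) (b : i ⟶ m), p = lift (standardSimplex.map a) (standardSimplex.map b) := by
  obtain ⟨a, ha⟩ := SSet.stdSimplex.{v}.map_surjective (p ≫ fst _ _)
  obtain ⟨b, hb⟩ := SSet.stdSimplex.{v}.map_surjective (p ≫ snd _ _)
  refine ⟨a, b, ?_⟩
  ext1
  · rw [lift_fst]; exact ha.symm
  · rw [lift_snd]; exact hb.symm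

lemma lift_standardSimplex_injective {i n m : SimplexCategory} {a a' : i ⟶ n} {b b' : i ⟶ m}
    (h : lift (standardSimplex.{v}.map a) (standardSimplex.map b) =
      lift (standardSimplex.map a') (standardSimplex.map b')) : a = a' ∧ b = b' :=
  ⟨SSet.stdSimplex.{v}.map_injective (by simpa using! h =≫ fst _ _),
    SSet.stdSimplex.{v}.map_injective (by simpa using! h =≫ snd _ _)⟩

variable [CartesianMonoidalCategory C] {F : SSet.{v} ⥤ C}

section

variable [MonoidalClosed C] [F.IsLeftAdjoint]

lemma tensor_map_hom_ext {W : C} {P : SSet.{v}} {T : C} {f g : W ⊗ F.obj P ⟶ T}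
    (h : ∀ (i : SimplexCategory) (p : standardSimplex.obj i ⟶ P),
      W ◁ F.map p ≫ f = W ◁ F.map p ≫ g) : f = g := by
  apply MonoidalClosed.curry_injective
  apply ((Adjunction.ofIsLeftAdjoint F).homEquiv _ _).injective
  apply sset_hom_ext
  intro i p
  rw [← Adjunction.homEquiv_naturality_left,
    ← Adjunction.homEquiv_naturality_left, ← MonoidalClosed.curry_natural_left,
    ← MonoidalClosed.curry_natural_left, h]

lemma exists_tensor_map_desc {W : C} {P : SSet.{v}} {T : C}
    (f : ∀ (i : SimplexCategory) (_ : standardSimplex.obj i ⟶ P),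
      W ⊗ F.obj (standardSimplex.obj i) ⟶ T)
    (hf : ∀ {i j : SimplexCategory} (c : i ⟶ j) (p : standardSimplex.obj j ⟶ P),
      W ◁ F.map (standardSimplex.map c) ≫ f j p = f i (standardSimplex.map c ≫ p)) :
    ∃ g : W ⊗ F.obj P ⟶ T, ∀ i p, W ◁ F.map p ≫ g = f i p := by
  let adj := Adjunction.ofIsLeftAdjoint F
  let k : P ⟶ F.rightAdjoint.obj ((ihom W).obj T) :=
    { app i := ↾fun p ↦ yonedaEquiv (adj.homEquiv _ _ (MonoidalClosed.curry
        (f i.unop (yonedaEquiv.symm p))))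
      naturality := by
        rintro ⟨i⟩ ⟨j⟩ c
        ext p
        obtain ⟨p, rfl⟩ := yonedaEquiv.surjective p
        change yonedaEquiv (adj.homEquiv _ _ (MonoidalClosed.curry
          (f j (yonedaEquiv.symm (P.map c (yonedaEquiv p)))))) =
            (F.rightAdjoint.obj ((ihom W).obj T)).map c (yonedaEquiv (adj.homEquiv _ _
              (MonoidalClosed.curry (f i (yonedaEquiv.symm (yonedaEquiv p))))))
        rw [yonedaEquiv_naturality, yonedaEquiv_naturality, Equiv.symm_apply_apply,
          Equiv.symm_apply_apply, ← Adjunction.homEquiv_naturality_left,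
          ← MonoidalClosed.curry_natural_left, hf] }
  refine ⟨MonoidalClosed.uncurry ((adj.homEquiv _ _).symm k), fun i p ↦ ?_⟩
  apply MonoidalClosed.curry_injective
  rw [MonoidalClosed.curry_natural_left, MonoidalClosed.curry_uncurry]
  apply (adj.homEquiv _ _).injective
  rw [Adjunction.homEquiv_naturality_left, Equiv.apply_symm_apply]
  apply yonedaEquiv.injective
  change yonedaEquiv (adj.homEquiv _ _ (MonoidalClosed.curry
    (f i (yonedaEquiv.symm (yonedaEquiv p))))) = _
  rw [Equiv.symm_apply_apply]

end

/-- The canonical map `(W₁ × W₂) × F(P × Q) ⟶ (W₁ × F P) × (W₂ × F Q)`. -/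
def rearrange (F : SSet.{v} ⥤ C) (W₁ W₂ : C) (P Q : SSet.{v}) :
    (W₁ ⊗ W₂) ⊗ F.obj (P ⊗ Q) ⟶ (W₁ ⊗ F.obj P) ⊗ (W₂ ⊗ F.obj Q) :=
  lift (lift (fst _ _ ≫ fst _ _) (snd _ _ ≫ F.map (fst _ _)))
    (lift (fst _ _ ≫ snd _ _) (snd _ _ ≫ F.map (snd _ _)))

instance isIso_rearrange (W₁ W₂ : C) (P Q : SSet.{v}) [BraidedCategory C] [F.Braided] :
    IsIso (rearrange F W₁ W₂ P Q) := by
  refine ⟨lift (fst _ _ ⊗ₘ fst _ _) (snd _ _ ⊗ₘ snd _ _) ≫ _ ◁ Functor.LaxMonoidal.μ F P Q,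
    ?_, ?_⟩
  · have h : rearrange F W₁ W₂ P Q ≫ lift (fst _ _ ⊗ₘ fst _ _) (snd _ _ ⊗ₘ snd _ _) =
        _ ◁ lift (F.map (fst P Q)) (F.map (snd P Q)) := by
      ext <;> simp [rearrange]
    rw [reassoc_of% h, ← whiskerLeft_comp, Functor.Monoidal.lift_μ]
    simp
  · ext <;> simp [rearrange]

/-- The canonical map `(W₁ × W₂) × F(Δ^n × Δ^m) ⟶ (W₁ × F Δ^n) × (W₂ × F Δ^m)`. -/
def rearrangeSimplex (F : SSet.{v} ⥤ C) (W₁ W₂ : C) (n m : SimplexCategory) :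
    (W₁ ⊗ W₂) ⊗ F.obj (standardSimplex.obj n ⊗ standardSimplex.obj m) ⟶
      (W₁ ⊗ (cosimplicialObject F).obj n) ⊗ (W₂ ⊗ (cosimplicialObject F).obj m) :=
  rearrange F W₁ W₂ (standardSimplex.obj n) (standardSimplex.obj m)

instance isIso_rearrangeSimplex (W₁ W₂ : C) (n m : SimplexCategory)
    [BraidedCategory C] [F.Braided] : IsIso (rearrangeSimplex F W₁ W₂ n m) :=
  isIso_rearrange W₁ W₂ (standardSimplex.obj n) (standardSimplex.obj m)

lemma map_lift_rearrange (W₁ W₂ : C) {i n m : SimplexCategory} (a : i ⟶ n) (b : i ⟶ m) :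
    (W₁ ⊗ W₂) ◁ (show (cosimplicialObject F).obj i ⟶ _ from
      F.map (lift (standardSimplex.map a) (standardSimplex.map b))) ≫
      rearrangeSimplex F W₁ W₂ n m = probe (cosimplicialObject F) W₁ W₂ a b := by
  have h₁ : F.map (lift (standardSimplex.map a) (standardSimplex.map b)) ≫ F.map (fst _ _) =
      (cosimplicialObject F).map a := by
    rw [← Functor.map_comp, lift_fst]; rfl
  have h₂ : F.map (lift (standardSimplex.map a) (standardSimplex.map b)) ≫ F.map (snd _ _) =
      (cosimplicialObject F).map b := by
    rw [← Functor.map_comp, lift_snd]; rfl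
  rw [probe, ← h₁, ← h₂]
  dsimp only [rearrangeSimplex, rearrange]
  ext <;> simp [cosimplicialObject]

variable [MonoidalClosed C] [BraidedCategory C] [F.IsLeftAdjoint] [F.Braided]

lemma probe_hom_ext {W₁ W₂ T : C} {n m : SimplexCategory}
    {f g : (W₁ ⊗ (cosimplicialObject F).obj n) ⊗ (W₂ ⊗ (cosimplicialObject F).obj m) ⟶ T}
    (h : ∀ (i : SimplexCategory) (a : i ⟶ n) (b : i ⟶ m),
      probe (cosimplicialObject F) W₁ W₂ a b ≫ f =
        probe (cosimplicialObject F) W₁ W₂ a b ≫ g) : f = g := by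
  refine (cancel_epi (rearrangeSimplex F W₁ W₂ n m)).1 (tensor_map_hom_ext fun i p ↦ ?_)
  obtain ⟨a, b, rfl⟩ := exists_eq_lift p
  have := h i a b
  rwa [← map_lift_rearrange, Category.assoc, Category.assoc] at this

lemma exists_probe_desc {W₁ W₂ T : C} {n m : SimplexCategory}
    (f : ∀ (i : SimplexCategory) (_ : i ⟶ n) (_ : i ⟶ m),
      (W₁ ⊗ W₂) ⊗ (cosimplicialObject F).obj i ⟶ T)
    (hf : ∀ {i j : SimplexCategory} (c : i ⟶ j) (a : j ⟶ n) (b : j ⟶ m),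
      (W₁ ⊗ W₂) ◁ (cosimplicialObject F).map c ≫ f j a b = f i (c ≫ a) (c ≫ b)) :
    ∃ g : (W₁ ⊗ (cosimplicialObject F).obj n) ⊗ (W₂ ⊗ (cosimplicialObject F).obj m) ⟶ T,
      ∀ i a b, probe (cosimplicialObject F) W₁ W₂ (i := i) a b ≫ g = f i a b := by
  choose a b hab using @exists_eq_lift
  have ha {i : SimplexCategory} (a' : i ⟶ n) (b' : i ⟶ m) :
      a (lift (standardSimplex.{v}.map a') (standardSimplex.map b')) = a' :=
    (lift_standardSimplex_injective (hab _).symm).1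
  have hb {i : SimplexCategory} (a' : i ⟶ n) (b' : i ⟶ m) :
      b (lift (standardSimplex.{v}.map a') (standardSimplex.map b')) = b' :=
    (lift_standardSimplex_injective (hab _).symm).2
  obtain ⟨g, hg⟩ := exists_tensor_map_desc (F := F) (W := W₁ ⊗ W₂)
    (P := standardSimplex.obj n ⊗ standardSimplex.obj m) (fun i p ↦ f i (a p) (b p)) (by
      intro i j c p
      obtain ⟨a', b', rfl⟩ := exists_eq_lift p
      rw [comp_lift, ← Functor.map_comp, ← Functor.map_comp, ha, hb, ha, hb]
      exact hf c a' b')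
  refine ⟨inv (rearrangeSimplex F W₁ W₂ n m) ≫ g, fun i a' b' ↦ ?_⟩
  have := hg i (lift (standardSimplex.map a') (standardSimplex.map b'))
  rw [ha, hb] at this
  rw [← map_lift_rearrange, Category.assoc, IsIso.hom_inv_id_assoc]
  exact this

variable [HasColimits C]

/-- The structural morphisms `X_n × D^n ⟶ |X|`. -/
def realizationι₂ (D : SimplexCategory ⥤ C) (X Y : SimplexCategoryᵒᵖ ⥤ C) (n : SimplexCategory) :
    (X.obj (op n) ⊗ Y.obj (op n)) ⊗ D.obj n ⟶ (realization D).obj (X ⊗ Y) :=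
  realizationι D (X ⊗ Y) n

lemma realizationι₂_condition {D : SimplexCategory ⥤ C} (X Y : SimplexCategoryᵒᵖ ⥤ C)
    {n m : SimplexCategory} (a : n ⟶ m) :
    (X.map a.op ⊗ₘ Y.map a.op) ▷ D.obj n ≫ realizationι₂ D X Y n =
      (X.obj (op m) ⊗ Y.obj (op m)) ◁ D.map a ≫ realizationι₂ D X Y m :=
  realizationι_condition (X ⊗ Y) a

lemma realizationι₂_prodComparison {D : SimplexCategory ⥤ C} (X Y : SimplexCategoryᵒᵖ ⥤ C)
    (n : SimplexCategory) :
    realizationι₂ D X Y n ≫ prodComparison (realization D) X Y =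
      probe D (X.obj (op n)) (Y.obj (op n)) (𝟙 n) (𝟙 n) ≫
        (realizationι D X n ⊗ₘ realizationι D Y n) := by
  ext
  · have : realizationι₂ D X Y n ≫ (realization D).map (fst X Y) =
        fst _ _ ▷ _ ≫ realizationι D X n := realizationι_map (fst X Y) n
    rw [Category.assoc, prodComparison_fst, this, Category.assoc, tensorHom_fst,
      ← Category.assoc]
    congr 1
    ext <;> simp [probe]
  · have : realizationι₂ D X Y n ≫ (realization D).map (snd X Y) =
        snd _ _ ▷ _ ≫ realizationι D Y n := realizationι_map (snd X Y) n
    rw [Category.assoc, prodComparison_snd, this, Category.assoc, tensorHom_snd,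
      ← Category.assoc]
    congr 1
    ext <;> simp [probe]

lemma probe_comp_ι {D : SimplexCategory ⥤ C} (X Y : SimplexCategoryᵒᵖ ⥤ C)
    {i n m : SimplexCategory} (a : i ⟶ n) (b : i ⟶ m) :
    probe D (X.obj (op n)) (Y.obj (op m)) a b ≫ (realizationι D X n ⊗ₘ realizationι D Y m) =
      (X.map a.op ⊗ₘ Y.map b.op) ▷ D.obj i ≫
        probe D (X.obj (op i)) (Y.obj (op i)) (𝟙 i) (𝟙 i) ≫
        (realizationι D X i ⊗ₘ realizationι D Y i) := by
  ext
  · have h₁ : probe D (X.obj (op n)) (Y.obj (op m)) a b ≫ fst _ _ =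
      fst _ _ ▷ _ ≫ _ ◁ D.map a := by ext <;> simp [probe]
    have h₂ : (X.map a.op ⊗ₘ Y.map b.op) ▷ D.obj i ≫
        probe D (X.obj (op i)) (Y.obj (op i)) (𝟙 i) (𝟙 i) ≫ fst _ _ =
      fst _ _ ▷ _ ≫ X.map a.op ▷ _ := by ext <;> simp [probe]
    simp only [Category.assoc, tensorHom_fst]
    rw [reassoc_of% h₁, reassoc_of% h₂, realizationι_condition]
  · have h₁ : probe D (X.obj (op n)) (Y.obj (op m)) a b ≫ snd _ _ =
      snd _ _ ▷ _ ≫ _ ◁ D.map b := by ext <;> simp [probe]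
    have h₂ : (X.map a.op ⊗ₘ Y.map b.op) ▷ D.obj i ≫
        probe D (X.obj (op i)) (Y.obj (op i)) (𝟙 i) (𝟙 i) ≫ snd _ _ =
      snd _ _ ▷ _ ≫ Y.map b.op ▷ _ := by ext <;> simp [probe]
    simp only [Category.assoc, tensorHom_snd]
    rw [reassoc_of% h₁, reassoc_of% h₂, realizationι_condition]

instance isIso_prodComparison_realization (X Y : SimplexCategoryᵒᵖ ⥤ C) :
    IsIso (prodComparison (realization (cosimplicialObject F)) X Y) := by
  choose θ hθ using fun n m ↦ exists_probe_desc (F := F) (W₁ := X.obj (op n))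
    (W₂ := Y.obj (op m)) (T := (realization (cosimplicialObject F)).obj (X ⊗ Y)) (n := n) (m := m)
    (fun i a b ↦ (X.map a.op ⊗ₘ Y.map b.op) ▷ _ ≫ realizationι₂ _ X Y i) (by
      intro i j c a b
      rw [whisker_exchange_assoc, ← realizationι₂_condition, ← comp_whiskerRight_assoc,
        tensorHom_comp_tensorHom, ← Functor.map_comp, ← Functor.map_comp, ← op_comp, ← op_comp])
  obtain ⟨Θ, hΘ⟩ := exists_tensor_realization_desc (D := cosimplicialObject F) (X := X) (Y := Y) θ
    (by
      intro n n' c m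
      apply probe_hom_ext
      intro i a b
      rw [← Category.assoc, probe_naturality_left, Category.assoc, hθ,
        ← Category.assoc (probe _ _ _ _ _), probe_comp_left, hθ, ← comp_whiskerRight_assoc]
      simp only [MonoidalCategory.tensorHom_def, op_comp, Functor.map_comp, comp_whiskerRight, Category.assoc])
    (by
      intro n m m' c
      apply probe_hom_ext
      intro i a b
      rw [← Category.assoc, probe_naturality_right, Category.assoc, hθ,
        ← Category.assoc (probe _ _ _ _ _), probe_comp_right, hθ, ← comp_whiskerRight_assoc]
      simp only [MonoidalCategory.tensorHom_def', op_comp, Functor.map_comp, whiskerLeft_comp, Category.assoc])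
  have key (n : SimplexCategory) :
      realizationι₂ _ X Y n ≫ prodComparison (realization (cosimplicialObject F)) X Y ≫ Θ =
        realizationι₂ _ X Y n := by
    rw [← Category.assoc, realizationι₂_prodComparison, Category.assoc, hΘ, hθ]
    simp
  refine ⟨Θ, realization_hom_ext fun n ↦ (key n).trans (Category.comp_id _).symm, ?_⟩
  apply tensor_realization_hom_ext
  intro n m
  rw [← Category.assoc, hΘ]
  apply probe_hom_ext
  intro i a b
  rw [← Category.assoc, hθ, Category.assoc, realizationι₂_prodComparison, Category.comp_id]
  exact (probe_comp_ι X Y a b).symm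


/-- The canonical map `|c A| ⟶ A` for the constant simplicial object `c A`. -/
def realizationConstHom (D : SimplexCategory ⥤ C) (A : C) :
    (realization D).obj ((Functor.const _).obj A) ⟶ A :=
  realizationDesc (X := (Functor.const _).obj A) (fun _ ↦ fst _ _) (by intros; simp)

lemma realizationι_constHom (D : SimplexCategory ⥤ C) (A : C) (n : SimplexCategory) :
    realizationι D ((Functor.const _).obj A) n ≫ realizationConstHom D A = fst A (D.obj n) :=
  realizationι_desc (X := (Functor.const _).obj A) (fun _ ↦ fst _ _) (by intros; simp) n

/-- The unit `1 ≅ F Δ^0`, as a morphism. -/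
def unitToSimplexZero (F : SSet.{v} ⥤ C) [F.Braided] :
    𝟙_ C ⟶ (cosimplicialObject F).obj (SimplexCategory.mk 0) :=
  Functor.LaxMonoidal.ε F ≫
    F.map ((show Limits.IsTerminal (standardSimplex.obj (SimplexCategory.mk 0)) from
      SSet.stdSimplex.isTerminalObj₀).from (𝟙_ SSet.{v}))

/-- The composite `A ≅ A × 1 ≅ A × F Δ^0 ⟶ |c A|`. -/
def realizationConstInv (F : SSet.{v} ⥤ C) [F.Braided] (A : C) :
    A ⟶ (realization (cosimplicialObject F)).obj ((Functor.const _).obj A) :=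
  (ρ_ A).inv ≫ A ◁ unitToSimplexZero F ≫
    realizationι (cosimplicialObject F) ((Functor.const _).obj A) (SimplexCategory.mk 0)

lemma cosimplicialObject_zero_hom_ext {T : C}
    (f g : T ⟶ (cosimplicialObject F).obj (SimplexCategory.mk 0)) : f = g :=
  (Limits.IsTerminal.isTerminalObj F _ SSet.stdSimplex.isTerminalObj₀).hom_ext f g

/-- The realization of a constant simplicial object is the object itself. -/
def realizationConstIso (F : SSet.{v} ⥤ C) [F.Braided] [F.IsLeftAdjoint] (A : C) :
    (realization (cosimplicialObject F)).obj ((Functor.const _).obj A) ≅ A where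
  hom := realizationConstHom _ A
  inv := realizationConstInv F A
  hom_inv_id := by
    apply realization_hom_ext
    intro n
    have h := realizationι_condition (D := cosimplicialObject F)
      ((Functor.const SimplexCategoryᵒᵖ).obj A) (SimplexCategory.const n (SimplexCategory.mk 0) 0)
    simp only [Functor.const_obj_obj, Functor.const_obj_map, id_whiskerRight,
      Category.id_comp] at h
    rw [← Category.assoc, realizationι_constHom]
    dsimp only [realizationConstInv]
    refine Eq.trans ?_ (h.symm.trans (Category.comp_id _).symm)
    simp only [← Category.assoc]
    congr 1
    refine CartesianMonoidalCategory.hom_ext _ _ ?_ (cosimplicialObject_zero_hom_ext _ _)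
    simp
  inv_hom_id := by
    dsimp only [realizationConstInv]
    simp only [Category.assoc]
    rw [realizationι_constHom]
    simp

instance isIso_terminalComparison_realization :
    IsIso (terminalComparison (realization (cosimplicialObject F))) := by
  have : terminalComparison (realization (cosimplicialObject F)) =
    (realizationConstIso F (𝟙_ C)).hom := toUnit_unique _ _
  rw [this]
  infer_instance

instance preservesFiniteProducts_realization :
    Limits.PreservesFiniteProducts (realization (cosimplicialObject F)) := by
  have := preservesLimitsOfShape_discrete_walkingPair_of_isIso_prodComparison
    (realization (cosimplicialObject F))
  have := preservesLimit_empty_of_isIso_terminalComparison (realization (cosimplicialObject F))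
  have := Limits.preservesLimitsOfShape_pempty_of_preservesTerminal
    (realization (cosimplicialObject F))
  exact .of_preserves_binary_and_terminal _

/-- The realization with respect to `F Δ^•` is a cartesian functor, i.e. it is strong symmetric
monoidal for the categorical products. -/
instance braidedRealization : (realization (cosimplicialObject F)).Braided :=
  .ofChosenFiniteProducts _

end Standard

section Ab

variable (C : Type u) [Category.{v} C] [CartesianMonoidalCategory C] [BraidedCategory C]

/-- An abelian group object of a cartesian category. -/
structure AbObj where
  /-- The underlying object. -/
  X : C
  [addGrp : AddGrpObj X]
  [comm : IsCommAddMonObj X]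

namespace AbObj

attribute [instance] addGrp comm

variable {C}

/-- A morphism of abelian group objects. -/
@[ext]
structure Hom (A B : AbObj C) where
  /-- The underlying morphism. -/
  hom : A.X ⟶ B.X
  [isAddMonHom : IsAddMonHom hom]

attribute [instance] Hom.isAddMonHom

instance : Category (AbObj C) where
  Hom A B := Hom A B
  id A := { hom := 𝟙 _ }
  comp f g := { hom := f.hom ≫ g.hom }

@[ext]
lemma hom_ext {A B : AbObj C} {f g : A ⟶ B} (h : f.hom = g.hom) : f = g :=
  Hom.ext h

@[simp] lemma id_hom (A : AbObj C) : Hom.hom (𝟙 A) = 𝟙 A.X := rfl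

@[simp] lemma comp_hom {A B E : AbObj C} (f : A ⟶ B) (g : B ⟶ E) :
    (f ≫ g).hom = f.hom ≫ g.hom := rfl

end AbObj

variable {C}

/-- The additive group of a ring object. -/
def ringToAb : RingObjCat C ⥤ AbObj C where
  obj S := { X := S.X }
  map f := { hom := f.hom }

section map

variable {E : Type u'} [Category.{v'} E] [CartesianMonoidalCategory E] [BraidedCategory E]
  (G : C ⥤ E) [G.Braided]

open scoped CategoryTheory.Obj

lemma isCommAddMonObj_obj (A : C) [AddMonObj A] [IsCommAddMonObj A] :
    IsCommAddMonObj (G.obj A) where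
  add_comm := by
    dsimp
    rw [← Functor.LaxBraided.braided_assoc, ← Functor.map_comp, IsCommAddMonObj.add_comm]

variable {A B M K : C}

lemma map_left_unit (one : 𝟙_ C ⟶ A) (mul : A ⊗ B ⟶ B) (h : one ▷ B ≫ mul = (λ_ B).hom) :
    (Functor.LaxMonoidal.ε G ≫ G.map one) ▷ G.obj B ≫ Functor.LaxMonoidal.μ G A B ≫ G.map mul =
      (λ_ (G.obj B)).hom := by
  rw [comp_whiskerRight, Category.assoc, Functor.LaxMonoidal.μ_natural_left_assoc,
    ← Functor.map_comp, h, Functor.LaxMonoidal.left_unitality]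

lemma map_right_unit (one : 𝟙_ C ⟶ A) (mul : B ⊗ A ⟶ B) (h : B ◁ one ≫ mul = (ρ_ B).hom) :
    G.obj B ◁ (Functor.LaxMonoidal.ε G ≫ G.map one) ≫ Functor.LaxMonoidal.μ G B A ≫ G.map mul =
      (ρ_ (G.obj B)).hom := by
  rw [whiskerLeft_comp, Category.assoc, Functor.LaxMonoidal.μ_natural_right_assoc,
    ← Functor.map_comp, h, Functor.LaxMonoidal.right_unitality]

lemma map_assoc {AB BM : C} (mul₁ : A ⊗ B ⟶ AB) (mul₂ : AB ⊗ M ⟶ K) (mul₃ : B ⊗ M ⟶ BM)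
    (mul₄ : A ⊗ BM ⟶ K) (h : mul₁ ▷ M ≫ mul₂ = (α_ A B M).hom ≫ A ◁ mul₃ ≫ mul₄) :
    (Functor.LaxMonoidal.μ G A B ≫ G.map mul₁) ▷ G.obj M ≫ Functor.LaxMonoidal.μ G AB M ≫
        G.map mul₂ =
      (α_ (G.obj A) (G.obj B) (G.obj M)).hom ≫
        G.obj A ◁ (Functor.LaxMonoidal.μ G B M ≫ G.map mul₃) ≫ Functor.LaxMonoidal.μ G A BM ≫
          G.map mul₄ := by
  rw [comp_whiskerRight, Category.assoc, Functor.LaxMonoidal.μ_natural_left_assoc,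
    ← Functor.map_comp, h, whiskerLeft_comp, Category.assoc,
    Functor.LaxMonoidal.μ_natural_right_assoc, Functor.map_comp, Functor.map_comp,
    Functor.LaxMonoidal.associativity_assoc]

lemma map_left_distrib [AddMonObj M] [AddMonObj K] (mul : A ⊗ M ⟶ K)
    (h : A ◁ AddMonObj.add ≫ mul =
      lift ((A ◁ fst _ _) ≫ mul) ((A ◁ snd _ _) ≫ mul) ≫ AddMonObj.add) :
    G.obj A ◁ AddMonObj.add ≫ Functor.LaxMonoidal.μ G A M ≫ G.map mul =
      lift ((G.obj A ◁ fst _ _) ≫ Functor.LaxMonoidal.μ G A M ≫ G.map mul)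
        ((G.obj A ◁ snd _ _) ≫ Functor.LaxMonoidal.μ G A M ≫ G.map mul) ≫ AddMonObj.add := by
  have h₁ : G.obj A ◁ fst (G.obj M) (G.obj M) ≫ Functor.LaxMonoidal.μ G A M =
      G.obj A ◁ Functor.LaxMonoidal.μ G M M ≫ Functor.LaxMonoidal.μ G _ _ ≫
        G.map (A ◁ fst M M) := by
    rw [← Functor.Monoidal.μ_fst, whiskerLeft_comp, Category.assoc,
      Functor.LaxMonoidal.μ_natural_right]
  have h₂ : G.obj A ◁ snd (G.obj M) (G.obj M) ≫ Functor.LaxMonoidal.μ G A M =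
      G.obj A ◁ Functor.LaxMonoidal.μ G M M ≫ Functor.LaxMonoidal.μ G _ _ ≫
        G.map (A ◁ snd M M) := by
    rw [← Functor.Monoidal.μ_snd, whiskerLeft_comp, Category.assoc,
      Functor.LaxMonoidal.μ_natural_right]
  have h₃ (Q : C) [AddMonObj Q] : (AddMonObj.add : G.obj Q ⊗ G.obj Q ⟶ G.obj Q) =
    Functor.LaxMonoidal.μ G Q Q ≫ G.map AddMonObj.add := rfl
  simp only [h₃]
  rw [reassoc_of% h₁, reassoc_of% h₂, ← Functor.map_comp, ← Functor.map_comp, ← comp_lift_assoc,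
    ← comp_lift_assoc, Functor.Monoidal.lift_μ_assoc, ← Functor.map_comp, ← h]
  simp

lemma map_right_distrib [AddMonObj M] [AddMonObj K] (mul : M ⊗ A ⟶ K)
    (h : AddMonObj.add ▷ A ≫ mul =
      lift ((fst _ _ ▷ A) ≫ mul) ((snd _ _ ▷ A) ≫ mul) ≫ AddMonObj.add) :
    AddMonObj.add ▷ G.obj A ≫ Functor.LaxMonoidal.μ G M A ≫ G.map mul =
      lift ((fst _ _ ▷ G.obj A) ≫ Functor.LaxMonoidal.μ G M A ≫ G.map mul)
        ((snd _ _ ▷ G.obj A) ≫ Functor.LaxMonoidal.μ G M A ≫ G.map mul) ≫ AddMonObj.add := by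
  have h₁ : fst (G.obj M) (G.obj M) ▷ G.obj A ≫ Functor.LaxMonoidal.μ G M A =
      Functor.LaxMonoidal.μ G M M ▷ G.obj A ≫ Functor.LaxMonoidal.μ G _ _ ≫
        G.map (fst M M ▷ A) := by
    rw [← Functor.Monoidal.μ_fst, comp_whiskerRight, Category.assoc,
      Functor.LaxMonoidal.μ_natural_left]
  have h₂ : snd (G.obj M) (G.obj M) ▷ G.obj A ≫ Functor.LaxMonoidal.μ G M A =
      Functor.LaxMonoidal.μ G M M ▷ G.obj A ≫ Functor.LaxMonoidal.μ G _ _ ≫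
        G.map (snd M M ▷ A) := by
    rw [← Functor.Monoidal.μ_snd, comp_whiskerRight, Category.assoc,
      Functor.LaxMonoidal.μ_natural_left]
  have h₃ (Q : C) [AddMonObj Q] : (AddMonObj.add : G.obj Q ⊗ G.obj Q ⟶ G.obj Q) =
    Functor.LaxMonoidal.μ G Q Q ≫ G.map AddMonObj.add := rfl
  simp only [h₃]
  rw [reassoc_of% h₁, reassoc_of% h₂, ← Functor.map_comp, ← Functor.map_comp, ← comp_lift_assoc,
    ← comp_lift_assoc, Functor.Monoidal.lift_μ_assoc, ← Functor.map_comp, ← h]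
  simp

/-- The functor induced on abelian group objects by a cartesian functor `G`. -/
def mapAb : AbObj C ⥤ AbObj E where
  obj A :=
    { X := G.obj A.X
      addGrp := Functor.addGrpObjObj (F := G)
      comm := isCommAddMonObj_obj G A.X }
  map f :=
    { hom := G.map f.hom
      isAddMonHom := inferInstance }

/-- The functor induced on ring objects by a cartesian functor `G`. -/
def mapRing : RingObjCat C ⥤ RingObjCat E where
  obj S :=
    { X := G.obj S.X
      ringObj :=
        { toAddGrpObj := Functor.addGrpObjObj (F := G)
          toIsCommAddMonObj := isCommAddMonObj_obj G S.X
          toMonObj := Functor.monObjObj (F := G) S.X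
          mul_add := map_left_distrib G _ (RingObj.mul_add S.X)
          add_mul := map_right_distrib G _ (RingObj.add_mul S.X) } }
  map f :=
    { hom := G.map f.hom
      isRingHom :=
        { toIsAddMonHom := inferInstance
          toIsMonHom := inferInstance } }

end map
end Ab
section Bar

variable {C : Type u} [Category.{v} C] [CartesianMonoidalCategory C] [BraidedCategory C]

open scoped AddMonObj

/-- The power `A^n`. -/
def power (A : C) (n : ℕ) : C := ∏ᶜ fun _ : Fin n ↦ A

/-- The projection `A^n ⟶ A`. -/
def power.π (A : C) {n : ℕ} (i : Fin n) : power A n ⟶ A :=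
  Limits.Pi.π (fun _ : Fin n ↦ A) i

/-- The morphism to `A^n` with given components. -/
def power.lift {A T : C} {n : ℕ} (f : Fin n → (T ⟶ A)) : T ⟶ power A n :=
  Limits.Pi.lift f

@[simp]
lemma power.lift_π {A T : C} {n : ℕ} (f : Fin n → (T ⟶ A)) (i : Fin n) :
    power.lift f ≫ power.π A i = f i :=
  Limits.Pi.lift_π f i

lemma power.hom_ext {A T : C} {n : ℕ} {f g : T ⟶ power A n}
    (h : ∀ i, f ≫ power.π A i = g ≫ power.π A i) : f = g :=
  Limits.Pi.hom_ext _ _ h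

lemma comp_sum {T T' A : C} [AddGrpObj A] [IsCommAddMonObj A] {ι : Type*} (s : Finset ι)
    (f : T' ⟶ T) (g : ι → (T ⟶ A)) : f ≫ (∑ i ∈ s, g i) = ∑ i ∈ s, f ≫ g i := by
  classical
  induction s using Finset.induction_on with
  | empty => simp
  | insert i s hi ih => rw [Finset.sum_insert hi, Finset.sum_insert hi, AddMonObj.comp_add, ih]

lemma sum_comp {T A A' : C} [AddGrpObj A] [IsCommAddMonObj A] [AddGrpObj A'] [IsCommAddMonObj A']
    {ι : Type*} (s : Finset ι) (f : A ⟶ A') [IsAddMonHom f] (g : ι → (T ⟶ A)) :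
    (∑ i ∈ s, g i) ≫ f = ∑ i ∈ s, g i ≫ f := by
  classical
  induction s using Finset.induction_on with
  | empty => simp [AddMonObj.zero_comp]
  | insert i s hi ih => rw [Finset.sum_insert hi, Finset.sum_insert hi, AddMonObj.add_comp, ih]

/-- The elements `k` of `Fin m` with `f j ≤ k < f (j + 1)`. -/
def gaps {n m : SimplexCategory} (f : n ⟶ m) (j : Fin n.len) : Finset (Fin m.len) :=
  {k | f.toOrderHom j.castSucc ≤ k.castSucc ∧ k.castSucc < f.toOrderHom j.succ}

lemma mem_gaps {n m : SimplexCategory} (f : n ⟶ m) (j : Fin n.len) (k : Fin m.len) :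
    k ∈ gaps f j ↔ f.toOrderHom j.castSucc ≤ k.castSucc ∧ k.castSucc < f.toOrderHom j.succ := by
  simp [gaps]

lemma gaps_id (n : SimplexCategory) (j : Fin n.len) : gaps (𝟙 n) j = {j} := by
  ext k
  rw [mem_gaps, Finset.mem_singleton, Fin.ext_iff]
  change j.1 ≤ k.1 ∧ k.1 < j.1 + 1 ↔ k.1 = j.1
  omega

lemma gaps_comp {n m l : SimplexCategory} (f : n ⟶ m) (g : m ⟶ l) (j : Fin n.len) :
    gaps (f ≫ g) j = (gaps f j).biUnion (gaps g) := by
  ext k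
  simp only [Finset.mem_biUnion, mem_gaps]
  change g.toOrderHom (f.toOrderHom _) ≤ _ ∧ _ < g.toOrderHom (f.toOrderHom _) ↔ _
  constructor
  · rintro ⟨h₁, h₂⟩
    obtain ⟨x, hx, hmax⟩ := (Finset.univ.filter
      fun x ↦ g.toOrderHom x ≤ k.castSucc).exists_max_image id ⟨f.toOrderHom j.castSucc, by simpa⟩
    simp only [Finset.mem_filter_univ, id_eq] at hx hmax
    have hlt : x < f.toOrderHom j.succ := by
      by_contra! h
      exact absurd ((g.toOrderHom.monotone h).trans hx) (not_le.2 h₂)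
    have hne : x ≠ Fin.last m.len := fun h ↦ absurd (h ▸ hlt) (not_lt.2 (Fin.le_last _))
    refine ⟨x.castPred hne, ⟨by simpa using hmax _ h₁, by simpa using hlt⟩, by simpa using hx, ?_⟩
    by_contra! h
    have h' := hmax _ h
    exact absurd h' (not_le.2 (by simp [Fin.lt_def]))
  · rintro ⟨i, ⟨h₁, h₂⟩, h₃, h₄⟩
    exact ⟨(g.toOrderHom.monotone h₁).trans h₃,
      h₄.trans_le (g.toOrderHom.monotone (Fin.castSucc_lt_iff_succ_le.1 h₂))⟩

lemma gaps_disjoint {n m : SimplexCategory} (f : n ⟶ m) {i j : Fin n.len} (h : i ≠ j) :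
    Disjoint (gaps f i) (gaps f j) := by
  wlog hij : i < j generalizing i j
  · exact (this h.symm (lt_of_le_of_ne (not_lt.1 hij) h.symm)).symm
  rw [Finset.disjoint_left]
  intro k hi hj
  rw [mem_gaps] at hi hj
  have : f.toOrderHom i.succ ≤ f.toOrderHom j.castSucc :=
    f.toOrderHom.monotone (Fin.succ_le_castSucc_iff.2 hij)
  exact absurd ((hi.2.trans_le this).trans_le hj.1) (lt_irrefl _)

/-- For the coface `δ i`, the sum over `gaps (δ i) j` has one or two terms, so that the `i`-th face
`A^(n+1) ⟶ A^n` of `B_• A` drops the first coordinate (`i = 0`), drops the last one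
(`i = n + 1`), or adds the adjacent coordinates `i - 1` and `i` (otherwise); coordinates are
numbered from `0`. -/
lemma mem_gaps_δ {n : ℕ} (i : Fin (n + 2)) (j : Fin n) (k : Fin (n + 1)) :
    k ∈ gaps (SimplexCategory.δ i) j ↔
      (k.1 = j.1 ∧ j.1 < i.1) ∨ (k.1 = j.1 + 1 ∧ i.1 ≤ j.1 + 1) := by
  rw [mem_gaps]
  change i.succAbove j.castSucc ≤ k.castSucc ∧ k.castSucc < i.succAbove j.succ ↔ _
  simp only [Fin.succAbove, Fin.lt_def, Fin.le_def]
  split_ifs with h₁ h₂ h₂ <;> simp at h₁ h₂ ⊢ <;> omega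

/-- For the codegeneracy `σ i`, the sum over `gaps (σ i) j` has one term, or none when `j = i`, so
that the `i`-th degeneracy `A^n ⟶ A^(n+1)` of `B_• A` inserts the zero at position `i`. -/
lemma mem_gaps_σ {n : ℕ} (i : Fin (n + 1)) (j : Fin (n + 1)) (k : Fin n) :
    k ∈ gaps (SimplexCategory.σ i) j ↔
      (k.1 = j.1 ∧ j.1 < i.1) ∨ (k.1 + 1 = j.1 ∧ i.1 < j.1) := by
  rw [mem_gaps]
  change i.predAbove j.castSucc ≤ k.castSucc ∧ k.castSucc < i.predAbove j.succ ↔ _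
  simp only [Fin.predAbove, Fin.lt_def, Fin.le_def]
  split_ifs with h₁ h₂ h₂ <;> simp at h₁ h₂ ⊢ <;> omega

/-- The simplicial bar construction `B_• A` of an abelian group object `A` (written additively):
`B_n A = A^n`, and the simplicial operator attached to `f : [m] ⟶ [n]` sends `(x_k)` to the family
whose `j`-th coordinate is the sum of the `x_k` with `f j ≤ k < f (j + 1)`. On faces this gives:
drop the first coordinate, drop the last one, or add two adjacent ones; on degeneracies: insert a
zero. -/
def barSimplicialObj (A : C) [AddGrpObj A] [IsCommAddMonObj A] : SimplexCategoryᵒᵖ ⥤ C where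
  obj n := power A n.unop.len
  map f := power.lift fun j ↦ ∑ k ∈ gaps f.unop j, power.π A k
  map_id n := power.hom_ext fun j ↦ by simp [gaps_id]
  map_comp f g := power.hom_ext fun j ↦ by
    simp only [power.lift_π, unop_comp, gaps_comp, Category.assoc, comp_sum]
    rw [Finset.sum_biUnion (fun a _ b _ h ↦ gaps_disjoint _ h)]

section

variable (A : C) [AddGrpObj A] [IsCommAddMonObj A]

/-- The projections of `B_n A = A^n`. -/
def barπ (n : SimplexCategoryᵒᵖ) (j : Fin n.unop.len) : (barSimplicialObj A).obj n ⟶ A :=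
  power.π A j

/-- The morphism to `B_n A = A^n` with given components. -/
def barLift {T : C} {n : SimplexCategoryᵒᵖ} (f : Fin n.unop.len → (T ⟶ A)) :
    T ⟶ (barSimplicialObj A).obj n :=
  power.lift f

variable {A}

@[simp]
lemma barLift_π {T : C} {n : SimplexCategoryᵒᵖ} (f : Fin n.unop.len → (T ⟶ A))
    (j : Fin n.unop.len) : barLift A f ≫ barπ A n j = f j :=
  power.lift_π f j

@[simp]
lemma barLift_π_assoc {T : C} {n : SimplexCategoryᵒᵖ} (f : Fin n.unop.len → (T ⟶ A))
    (j : Fin n.unop.len) {Z : C} (h : A ⟶ Z) : barLift A f ≫ barπ A n j ≫ h = f j ≫ h := by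
  rw [← Category.assoc, barLift_π]

lemma bar_obj_hom_ext {T : C} {n : SimplexCategoryᵒᵖ} {f g : T ⟶ (barSimplicialObj A).obj n}
    (h : ∀ j, f ≫ barπ A n j = g ≫ barπ A n j) : f = g :=
  power.hom_ext h

@[simp]
lemma barSimplicialObj_map_π {n m : SimplexCategoryᵒᵖ} (f : n ⟶ m) (j : Fin m.unop.len) :
    (barSimplicialObj A).map f ≫ barπ A m j = ∑ k ∈ gaps f.unop j, barπ A n k :=
  power.lift_π _ _

@[simp]
lemma barSimplicialObj_map_π_assoc {n m : SimplexCategoryᵒᵖ} (f : n ⟶ m) (j : Fin m.unop.len)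
    {Z : C} (h : A ⟶ Z) : (barSimplicialObj A).map f ≫ barπ A m j ≫ h =
      (∑ k ∈ gaps f.unop j, barπ A n k) ≫ h := by
  rw [← Category.assoc, barSimplicialObj_map_π]

lemma bar_hom_ext {X : SimplexCategoryᵒᵖ ⥤ C} {f g : X ⟶ barSimplicialObj A}
    (h : ∀ (n : SimplexCategoryᵒᵖ) (j : Fin n.unop.len),
      f.app n ≫ barπ A n j = g.app n ≫ barπ A n j) : f = g := by
  ext n
  exact bar_obj_hom_ext (h n)

variable (A)

/-- The zero `1 ⟶ B_• A`. -/
def barZero : 𝟙_ (SimplexCategoryᵒᵖ ⥤ C) ⟶ barSimplicialObj A where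
  app n := barLift A fun _ ↦ 0
  naturality n m f := bar_obj_hom_ext fun j ↦ by
    simp [comp_sum]

/-- The addition of `B_• A`, degreewise that of `A^n`. -/
def barAdd : barSimplicialObj A ⊗ barSimplicialObj A ⟶ barSimplicialObj A where
  app n := barLift A fun j ↦
    (fst (barSimplicialObj A) (barSimplicialObj A)).app n ≫ barπ A n j +
      (snd (barSimplicialObj A) (barSimplicialObj A)).app n ≫ barπ A n j
  naturality n m f := bar_obj_hom_ext fun j ↦ by
    simp only [Category.assoc, barLift_π, barSimplicialObj_map_π, comp_sum, AddMonObj.comp_add,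
      Finset.sum_add_distrib, NatTrans.naturality_assoc]

/-- The negation of `B_• A`, degreewise that of `A^n`. -/
def barNeg : barSimplicialObj A ⟶ barSimplicialObj A where
  app n := barLift A fun j ↦ - barπ A n j
  naturality n m f := bar_obj_hom_ext fun j ↦ by
    simp only [Category.assoc, barLift_π, barSimplicialObj_map_π, comp_sum, AddGrpObj.comp_neg,
      Finset.sum_neg_distrib]

variable {A}
variable {X : SimplexCategoryᵒᵖ ⥤ C} (n : SimplexCategoryᵒᵖ) (j : Fin n.unop.len)

lemma comp_barZero_app_π (f : X ⟶ 𝟙_ _) :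
    (f ≫ barZero A).app n ≫ barπ A n j = 0 := by
  simp [barZero]

lemma lift_barAdd_app_π (f g : X ⟶ barSimplicialObj A) :
    (lift f g ≫ barAdd A).app n ≫ barπ A n j =
      f.app n ≫ barπ A n j + g.app n ≫ barπ A n j := by
  simp only [barAdd, NatTrans.comp_app, Category.assoc, barLift_π, AddMonObj.comp_add,
    ← NatTrans.comp_app_assoc, lift_fst, lift_snd]

lemma barAdd_app_π :
    (barAdd A).app n ≫ barπ A n j =
      (fst (barSimplicialObj A) (barSimplicialObj A)).app n ≫ barπ A n j +
      (snd (barSimplicialObj A) (barSimplicialObj A)).app n ≫ barπ A n j :=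
  barLift_π _ _

lemma comp_barNeg_app_π (f : X ⟶ barSimplicialObj A) :
    (f ≫ barNeg A).app n ≫ barπ A n j = - f.app n ≫ barπ A n j := by
  simp [barNeg, AddGrpObj.comp_neg]

variable (A)

/-- The abelian group structure on `B_• A`. -/
instance barAddGrpObj : AddGrpObj (barSimplicialObj A) where
  zero := barZero A
  add := barAdd A
  neg := barNeg A
  zero_add := by
    have h : barZero A ▷ barSimplicialObj A = lift (fst _ _ ≫ barZero A) (snd _ _) := by
      ext1 <;> simp
    rw [h]
    refine bar_hom_ext fun n j ↦ ?_
    rw [lift_barAdd_app_π, comp_barZero_app_π, zero_add, leftUnitor_hom]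
  add_zero := by
    have h : barSimplicialObj A ◁ barZero A = lift (fst _ _) (snd _ _ ≫ barZero A) := by
      ext1 <;> simp
    rw [h]
    refine bar_hom_ext fun n j ↦ ?_
    rw [lift_barAdd_app_π, comp_barZero_app_π, add_zero, rightUnitor_hom]
  add_assoc := by
    have h₁ : barAdd A ▷ barSimplicialObj A =
        lift (lift (fst _ _ ≫ fst _ _) (fst _ _ ≫ snd _ _) ≫ barAdd A) (snd _ _) := by
      ext1 <;> simp
    have h₂ : (α_ (barSimplicialObj A) (barSimplicialObj A) (barSimplicialObj A)).hom ≫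
        barSimplicialObj A ◁ barAdd A = lift (fst _ _ ≫ fst _ _)
          (lift (fst _ _ ≫ snd _ _) (snd _ _) ≫ barAdd A) := by
      have h₃ : (α_ (barSimplicialObj A) (barSimplicialObj A) (barSimplicialObj A)).hom ≫
          snd _ _ = lift (fst _ _ ≫ snd _ _) (snd _ _) := by ext1 <;> simp
      ext1
      · simp
      · simp only [Category.assoc, whiskerLeft_snd, lift_snd, reassoc_of% h₃]
    rw [h₁, reassoc_of% h₂]
    refine bar_hom_ext fun n j ↦ ?_
    simp only [lift_barAdd_app_π, add_assoc]
  left_neg := by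
    refine bar_hom_ext fun n j ↦ ?_
    rw [lift_barAdd_app_π, comp_barZero_app_π]
    simp [barNeg]
  right_neg := by
    refine bar_hom_ext fun n j ↦ ?_
    rw [lift_barAdd_app_π, comp_barZero_app_π]
    simp [barNeg]

instance barIsCommAddMonObj : IsCommAddMonObj (barSimplicialObj A) where
  add_comm := by
    change (β_ _ _).hom ≫ barAdd A = barAdd A
    have h : (β_ (barSimplicialObj A) (barSimplicialObj A)).hom = lift (snd _ _) (fst _ _) := by
      ext1 <;> simp
    rw [h]
    refine bar_hom_ext fun n j ↦ ?_
    rw [lift_barAdd_app_π, barAdd_app_π, add_comm]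

end

/-- `B_•` on morphisms, degreewise `f^n`. -/
def barSimplicialMap {A A' : C} [AddGrpObj A] [IsCommAddMonObj A] [AddGrpObj A']
    [IsCommAddMonObj A'] (f : A ⟶ A') [IsAddMonHom f] :
    barSimplicialObj A ⟶ barSimplicialObj A' where
  app n := barLift A' fun j ↦ barπ A n j ≫ f
  naturality n m g := bar_obj_hom_ext fun j ↦ by
    simp only [Category.assoc, barLift_π, barSimplicialObj_map_π, comp_sum,
      barSimplicialObj_map_π_assoc, sum_comp]

@[simp]
lemma barSimplicialMap_app_π {A A' : C} [AddGrpObj A] [IsCommAddMonObj A] [AddGrpObj A']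
    [IsCommAddMonObj A'] (f : A ⟶ A') [IsAddMonHom f] (n : SimplexCategoryᵒᵖ)
    (j : Fin n.unop.len) :
    (barSimplicialMap f).app n ≫ barπ A' n j = barπ A n j ≫ f :=
  barLift_π _ _

@[simp]
lemma barSimplicialMap_app_π_assoc {A A' : C} [AddGrpObj A] [IsCommAddMonObj A] [AddGrpObj A']
    [IsCommAddMonObj A'] (f : A ⟶ A') [IsAddMonHom f] (n : SimplexCategoryᵒᵖ)
    (j : Fin n.unop.len) {Z : C} (h : A' ⟶ Z) :
    (barSimplicialMap f).app n ≫ barπ A' n j ≫ h = barπ A n j ≫ f ≫ h := by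
  rw [← Category.assoc, barSimplicialMap_app_π, Category.assoc]

instance barSimplicialMap_isAddMonHom {A A' : C} [AddGrpObj A] [IsCommAddMonObj A] [AddGrpObj A']
    [IsCommAddMonObj A'] (f : A ⟶ A') [IsAddMonHom f] : IsAddMonHom (barSimplicialMap f) where
  zero_hom := by
    change barZero A ≫ _ = barZero A'
    refine bar_hom_ext fun n j ↦ ?_
    simp [barZero, AddMonObj.zero_comp]
  add_hom := by
    change barAdd A ≫ _ = _ ≫ barAdd A'
    refine bar_hom_ext fun n j ↦ ?_
    have h : barSimplicialMap f ⊗ₘ barSimplicialMap f =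
        lift (fst _ _ ≫ barSimplicialMap f) (snd _ _ ≫ barSimplicialMap f) := by
      ext1 <;> simp
    rw [h, lift_barAdd_app_π]
    simp only [barAdd, NatTrans.comp_app, Category.assoc, barSimplicialMap_app_π, barLift_π_assoc,
      AddMonObj.add_comp]

/-- The simplicial bar construction `B_•`, as a functor on abelian group objects. -/
def barSimplicial : AbObj C ⥤ AbObj (SimplexCategoryᵒᵖ ⥤ C) where
  obj A := { X := barSimplicialObj A.X }
  map f := { hom := barSimplicialMap f.hom }
  map_id A := AbObj.hom_ext (bar_hom_ext fun n j ↦ by simp)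
  map_comp f g := AbObj.hom_ext (bar_hom_ext fun n j ↦ by simp)

variable [MonoidalClosed C] [HasColimits C] (F : SSet.{v} ⥤ C) [F.Braided] [F.IsLeftAdjoint]

/-- The bar construction `B A = |B_• A|`, as a functor on abelian group objects. -/
def bar : AbObj C ⥤ AbObj C :=
  barSimplicial ⋙ mapAb (realization (cosimplicialObject F))

/-- The iterated bar constructions `B^n`. -/
def barIter : ℕ → (AbObj C ⥤ AbObj C)
  | 0 => 𝟭 _
  | n + 1 => barIter n ⋙ bar F

/-- The functor `B^*` from abelian group objects to graded abelian group objects. -/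
def barGraded : AbObj C ⥤ GradedObject ℕ (AbObj C) where
  obj A n := (barIter F n).obj A
  map f n := (barIter F n).map f

end Bar

section Graded

variable {C : Type u} [Category.{v} C] [CartesianMonoidalCategory C] [BraidedCategory C]

/-- A graded ring structure on a sequence of abelian group objects: a unit `1 ⟶ A_0` and
multiplications `A_n × A_m ⟶ A_k` for `n + m = k` that are associative, unital and
distributive. -/
@[ext]
structure GrRingStr (A : GradedObject ℕ (AbObj C)) where
  /-- The unit. -/
  one : 𝟙_ C ⟶ (A 0).X
  /-- The multiplication `A_n × A_m ⟶ A_{n + m}`. -/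
  mul (n m k : ℕ) (h : n + m = k) : (A n).X ⊗ (A m).X ⟶ (A k).X
  one_mul (n : ℕ) : one ▷ (A n).X ≫ mul 0 n n (zero_add n) = (λ_ (A n).X).hom
  mul_one (n : ℕ) : (A n).X ◁ one ≫ mul n 0 n (add_zero n) = (ρ_ (A n).X).hom
  mul_assoc (n m l nm ml k : ℕ) (h₁ : n + m = nm) (h₂ : m + l = ml) (h₃ : nm + l = k)
    (h₄ : n + ml = k) :
    mul n m nm h₁ ▷ (A l).X ≫ mul nm l k h₃ =
      (α_ (A n).X (A m).X (A l).X).hom ≫ (A n).X ◁ mul m l ml h₂ ≫ mul n ml k h₄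
  mul_add (n m k : ℕ) (h : n + m = k) :
    (A n).X ◁ AddMonObj.add ≫ mul n m k h =
      lift ((A n).X ◁ fst _ _ ≫ mul n m k h) ((A n).X ◁ snd _ _ ≫ mul n m k h) ≫ AddMonObj.add
  add_mul (n m k : ℕ) (h : n + m = k) :
    AddMonObj.add ▷ (A m).X ≫ mul n m k h =
      lift (fst _ _ ▷ (A m).X ≫ mul n m k h) (snd _ _ ▷ (A m).X ≫ mul n m k h) ≫ AddMonObj.add

/-- A morphism of graded abelian group objects is a morphism of graded rings when it is
compatible with the units and the multiplications. -/
structure IsGrRingHom {A B : GradedObject ℕ (AbObj C)} (R : GrRingStr A) (S : GrRingStr B)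
    (f : A ⟶ B) : Prop where
  map_one : R.one ≫ (f 0).hom = S.one
  map_mul (n m k : ℕ) (h : n + m = k) :
    R.mul n m k h ≫ (f k).hom = ((f n).hom ⊗ₘ (f m).hom) ≫ S.mul n m k h

lemma IsGrRingHom.id {A : GradedObject ℕ (AbObj C)} (R : GrRingStr A) :
    IsGrRingHom R R (𝟙 A) where
  map_one := Category.comp_id _
  map_mul n m k h := by
    change _ ≫ 𝟙 _ = (𝟙 _ ⊗ₘ 𝟙 _) ≫ _
    simp

lemma IsGrRingHom.comp {A₁ A₂ A₃ : GradedObject ℕ (AbObj C)} {R₁ : GrRingStr A₁}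
    {R₂ : GrRingStr A₂} {R₃ : GrRingStr A₃} {f : A₁ ⟶ A₂} {g : A₂ ⟶ A₃}
    (hf : IsGrRingHom R₁ R₂ f) (hg : IsGrRingHom R₂ R₃ g) : IsGrRingHom R₁ R₃ (f ≫ g) where
  map_one := by
    change _ ≫ (f 0).hom ≫ (g 0).hom = _
    rw [← Category.assoc, hf.map_one, hg.map_one]
  map_mul n m k h := by
    change _ ≫ (f k).hom ≫ (g k).hom = ((f n).hom ≫ (g n).hom ⊗ₘ (f m).hom ≫ (g m).hom) ≫ _
    rw [← Category.assoc, hf.map_mul, Category.assoc, hg.map_mul,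
      ← tensorHom_comp_tensorHom_assoc]

variable (C) in
/-- A graded ring object. -/
structure GrRing where
  /-- The underlying graded abelian group object. -/
  A : GradedObject ℕ (AbObj C)
  /-- The graded ring structure. -/
  str : GrRingStr A

namespace GrRing

/-- A morphism of graded ring objects. -/
@[ext]
structure Hom (R S : GrRing C) where
  /-- The underlying morphism of graded abelian group objects. -/
  hom : R.A ⟶ S.A
  isGrRingHom : IsGrRingHom R.str S.str hom

instance : Category (GrRing C) where
  Hom R S := Hom R S
  id R := ⟨𝟙 R.A, .id _⟩
  comp f g := ⟨f.hom ≫ g.hom, f.isGrRingHom.comp g.isGrRingHom⟩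

@[ext]
lemma hom_ext {R S : GrRing C} {f g : R ⟶ S} (h : f.hom = g.hom) : f = g :=
  Hom.ext h

variable (C) in
/-- The underlying graded abelian group object of a graded ring object. -/
def toGrAb : GrRing C ⥤ GradedObject ℕ (AbObj C) where
  obj R := R.A
  map f := f.hom

end GrRing

section map

variable {E : Type u'} [Category.{v'} E] [CartesianMonoidalCategory E] [BraidedCategory E]
  (G : C ⥤ E) [G.Braided]

open scoped CategoryTheory.Obj

/-- The functor `G` applied degreewise to graded abelian group objects. -/
def mapGrAb : GradedObject ℕ (AbObj C) ⥤ GradedObject ℕ (AbObj E) where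
  obj A n := (mapAb G).obj (A n)
  map f n := (mapAb G).map (f n)

/-- The graded ring structure on `G A`. -/
def GrRingStr.map {A : GradedObject ℕ (AbObj C)} (R : GrRingStr A) :
    GrRingStr ((mapGrAb G).obj A) where
  one := Functor.LaxMonoidal.ε G ≫ G.map R.one
  mul n m k h := Functor.LaxMonoidal.μ G (A n).X (A m).X ≫ G.map (R.mul n m k h)
  one_mul n := map_left_unit G _ _ (R.one_mul n)
  mul_one n := map_right_unit G _ _ (R.mul_one n)
  mul_assoc n m l nm ml k h₁ h₂ h₃ h₄ :=
    map_assoc G _ _ _ _ (R.mul_assoc n m l nm ml k h₁ h₂ h₃ h₄)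
  mul_add n m k h := map_left_distrib G _ (R.mul_add n m k h)
  add_mul n m k h := map_right_distrib G _ (R.add_mul n m k h)

/-- The functor induced by `G` on graded ring objects. -/
def mapGrRing : GrRing C ⥤ GrRing E where
  obj R := ⟨(mapGrAb G).obj R.A, R.str.map G⟩
  map {R S} f := ⟨(mapGrAb G).map f.hom,
    { map_one := by
        change (_ ≫ G.map _) ≫ G.map _ = _ ≫ G.map _
        rw [Category.assoc, ← Functor.map_comp, f.isGrRingHom.map_one]
      map_mul n m k h := by
        change (_ ≫ G.map _) ≫ G.map _ = (G.map _ ⊗ₘ G.map _) ≫ _ ≫ G.map _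
        rw [Category.assoc, ← Functor.map_comp, f.isGrRingHom.map_mul, Functor.map_comp,
          Functor.LaxMonoidal.μ_natural_assoc] }⟩
  map_id R := GrRing.hom_ext ((mapGrAb G).map_id _)
  map_comp f g := GrRing.hom_ext ((mapGrAb G).map_comp _ _)

end map

/-- An extension of a functor `P` with values in graded abelian group objects to a functor
with values in graded ring objects. -/
structure GrRingLift {R : Type u'} [Category.{v'} R] (P : R ⥤ GradedObject ℕ (AbObj C)) where
  /-- The graded ring structure on `P S`. -/
  str (S : R) : GrRingStr (P.obj S)
  isGrRingHom {S T : R} (f : S ⟶ T) : IsGrRingHom (str S) (str T) (P.map f)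

/-- The functor to graded ring objects given by a lift. -/
def GrRingLift.toFunctor {R : Type u'} [Category.{v'} R] {P : R ⥤ GradedObject ℕ (AbObj C)}
    (L : GrRingLift P) : R ⥤ GrRing C where
  obj S := ⟨P.obj S, L.str S⟩
  map f := ⟨P.map f, L.isGrRingHom f⟩
  map_id S := GrRing.hom_ext (P.map_id S)
  map_comp f g := GrRing.hom_ext (P.map_comp f g)

lemma GrRingLift.toFunctor_comp_toGrAb {R : Type u'} [Category.{v'} R]
    {P : R ⥤ GradedObject ℕ (AbObj C)} (L : GrRingLift P) :
    L.toFunctor ⋙ GrRing.toGrAb C = P := rfl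

end Graded

section Multiplication

variable {C : Type u} [Category.{v} C] [CartesianMonoidalCategory C] [BraidedCategory C]
  [MonoidalClosed C] [HasColimits C] (F : SSet.{v} ⥤ C) [F.Braided] [F.IsLeftAdjoint]

/-- The isomorphism `A × |X| ≅ |cA| × |X| ≅ |cA × X|`. -/
def tensorRealizationIso (A : C) (X : SimplexCategoryᵒᵖ ⥤ C) :
    A ⊗ (realization (cosimplicialObject F)).obj X ≅
      (realization (cosimplicialObject F)).obj ((Functor.const _).obj A ⊗ X) :=
  whiskerRightIso (realizationConstIso F A).symm _ ≪≫
    Functor.Monoidal.μIso (realization (cosimplicialObject F)) _ _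

/-- The isomorphism `|X| × A ≅ |X| × |cA| ≅ |X × cA|`. -/
def realizationTensorIso (X : SimplexCategoryᵒᵖ ⥤ C) (A : C) :
    (realization (cosimplicialObject F)).obj X ⊗ A ≅
      (realization (cosimplicialObject F)).obj (X ⊗ (Functor.const _).obj A) :=
  whiskerLeftIso _ (realizationConstIso F A).symm ≪≫
    Functor.Monoidal.μIso (realization (cosimplicialObject F)) _ _

/-- `g : A × B M ⟶ B N` is induced by `f : A × M ⟶ N`: the morphisms
`φ^p : A × M^p ⟶ N^p`, `(a, (x_i)) ↦ (f (a, x_i))`, form a simplicial morphism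
`φ : c A × B_• M ⟶ B_• N`, and `g` is the composite `A × |B_• M| ≅ |c A × B_• M| ⟶ |B_• N|`
of the canonical isomorphism and `|φ|`. -/
def IsBarExtensionRight {A : C} {M N : AbObj C} (f : A ⊗ M.X ⟶ N.X)
    (g : A ⊗ ((bar F).obj M).X ⟶ ((bar F).obj N).X) : Prop :=
  ∃ φ : (Functor.const _).obj A ⊗ barSimplicialObj M.X ⟶ barSimplicialObj N.X,
    (∀ (p : SimplexCategoryᵒᵖ) (i : Fin p.unop.len),
      φ.app p ≫ barπ N.X p i = A ◁ barπ M.X p i ≫ f) ∧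
    g = (tensorRealizationIso F A (barSimplicialObj M.X)).hom ≫
      (realization (cosimplicialObject F)).map φ

/-- `g : B M × A ⟶ B N` is induced by `f : M × A ⟶ N`: the morphisms
`φ^p : M^p × A ⟶ N^p`, `((x_i), a) ↦ (f (x_i, a))`, form a simplicial morphism
`φ : B_• M × c A ⟶ B_• N`, and `g` is the composite `|B_• M| × A ≅ |B_• M × c A| ⟶ |B_• N|`
of the canonical isomorphism and `|φ|`. -/
def IsBarExtensionLeft {M N : AbObj C} {A : C} (f : M.X ⊗ A ⟶ N.X)
    (g : ((bar F).obj M).X ⊗ A ⟶ ((bar F).obj N).X) : Prop :=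
  ∃ φ : barSimplicialObj M.X ⊗ (Functor.const _).obj A ⟶ barSimplicialObj N.X,
    (∀ (p : SimplexCategoryᵒᵖ) (i : Fin p.unop.len),
      φ.app p ≫ barπ N.X p i = barπ M.X p i ▷ A ≫ f) ∧
    g = (realizationTensorIso F (barSimplicialObj M.X) A).hom ≫
      (realization (cosimplicialObject F)).map φ

/-- The graded ring structure on `B^* S` is the inductively defined one: its unit is that of `S`, its
multiplication `S × S ⟶ S` in bidegree `(0, 0)` is that of `S`, the multiplication in bidegree
`(0, m + 1)` is induced by the one in bidegree `(0, m)` through the second variable, and the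
multiplication in bidegree `(n + 1, m)` is induced by the one in bidegree `(n, m)` through the first
variable. -/
structure IsBarMultiplication (S : RingObjCat C)
    (R : GrRingStr ((barGraded F).obj (ringToAb.obj S))) : Prop where
  one : R.one = (MonObj.one : 𝟙_ C ⟶ S.X)
  mul_zero_zero : R.mul 0 0 0 rfl = (MonObj.mul : S.X ⊗ S.X ⟶ S.X)
  mul_zero_succ (m : ℕ) :
    IsBarExtensionRight F (A := S.X) (M := (barIter F m).obj (ringToAb.obj S))
      (N := (barIter F m).obj (ringToAb.obj S))
      (R.mul 0 m m (zero_add m)) (R.mul 0 (m + 1) (m + 1) (zero_add (m + 1)))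
  mul_succ (n m k : ℕ) (h : n + m = k) :
    IsBarExtensionLeft F (M := (barIter F n).obj (ringToAb.obj S))
      (N := (barIter F k).obj (ringToAb.obj S)) (A := ((barIter F m).obj (ringToAb.obj S)).X)
      (R.mul n m k h) (R.mul (n + 1) m (k + 1) (by omega))

end Multiplication

end BarConstruction

/-!
A point of an object is a morphism into it from an arbitrary object, so that `lift a b` is the pair
`(a, b)`. Write `[x, t]` for the point `lift x t ≫ barι F M n` of `B M` given by a point `x` of
`M^n` and a point `t` of `F Δ^n`.
In a cartesian closed category a morphism out of `A × B M` is determined by its values on the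
points `(a, [x, t])`, because `A × -` preserves the coend defining `B M`. A pairing
`f : A × M ⟶ N` that is additive in `M` therefore has at most one extension
`g : A × B M ⟶ B N` with `g (a, [(x_i), t]) = [(f (a, x_i)), t]` (`ExtendsRight`,
`ExtendsLeft`). It has one because additivity of `f` is what makes `(a, (x_i)) ↦ (f (a, x_i))`
commute with the simplicial operators of `B_•`, which are given by sums of coordinates
(`barPairing`), and this extension is the one obtained by realizing the simplicial morphism
(`IsBarExtensionRight.extendsRight`, `ExtendsRight.isBarExtensionRight`).

The extension is again additive in each variable. For the variable `B M` this uses that a point of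
`B M × B M` is generated by pairs `([x, t], [y, t])` with the same `t`, as realization preserves
products, together with `[x, t] + [y, t] = [x + y, t]`. So the multiplications
`B^n S × B^m S ⟶ B^{n + m} S` can be constructed by induction (`barMul`). Unitality and
naturality pass from pairings to their extensions by evaluation on generators; so does
associativity, in three forms according to the variable that is extended (`ExtendsRight.assoc`,
`ExtendsRight.assoc_extendsLeft`, `ExtendsLeft.assoc`), which matches an induction on `n`, then on
`m`, then on `l` for the triple products of degrees `(n, m, l)`.

For a cartesian left adjoint `G`, the functor `G` preserves the products and the coend that define
`B M`, so `[G x, G t] ↦ G [x, t]` is an isomorphism `B (G M) ≅ G (B M)` (`barComparison`). On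
generators it is additive, natural, and compatible with extensions of pairings
(`ExtendsRight.baseChange`, `ExtendsLeft.baseChange`). Iterating it gives isomorphisms
`B^n (G S) ≅ G (B^n S)` that respect the multiplications, by the same induction.
-/

namespace BarConstruction

open scoped AddMonObj CategoryTheory.Obj

/-! ### Morphisms additive in one variable -/

section Additive

variable {C : Type u} [Category.{v} C] [CartesianMonoidalCategory C] [BraidedCategory C]

/-- A morphism `A × M ⟶ N` that is additive in the second variable, on generalized elements. -/
def IsAdditiveRight {A M N : C} [AddMonObj M] [AddMonObj N] (f : A ⊗ M ⟶ N) : Prop :=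
  ∀ ⦃T : C⦄ (a : T ⟶ A) (x y : T ⟶ M), lift a (x + y) ≫ f = lift a x ≫ f + lift a y ≫ f

/-- A morphism `M × A ⟶ N` that is additive in the first variable, on generalized elements. -/
def IsAdditiveLeft {M A N : C} [AddMonObj M] [AddMonObj N] (f : M ⊗ A ⟶ N) : Prop :=
  ∀ ⦃T : C⦄ (x y : T ⟶ M) (a : T ⟶ A), lift (x + y) a ≫ f = lift x a ≫ f + lift y a ≫ f

lemma isAdditiveRight_iff {A M N : C} [AddMonObj M] [AddMonObj N] {f : A ⊗ M ⟶ N} :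
    IsAdditiveRight f ↔ A ◁ AddMonObj.add ≫ f =
      lift (A ◁ fst _ _ ≫ f) (A ◁ snd _ _ ≫ f) ≫ AddMonObj.add := by
  constructor
  · intro h
    have := h (fst A (M ⊗ M)) (snd _ _ ≫ fst _ _) (snd _ _ ≫ snd _ _)
    convert! this using 1
    · congr 1
      ext
      · simp
      · simp [Hom.add_def]
    · rw [Hom.add_def]
      congr 3 <;> ext <;> simp
  · intro h T a x y
    have := lift a (lift x y) ≫= h
    simpa [Hom.add_def, comp_lift_assoc] using this

lemma isAdditiveLeft_iff {A M N : C} [AddMonObj M] [AddMonObj N] {f : M ⊗ A ⟶ N} :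
    IsAdditiveLeft f ↔ AddMonObj.add ▷ A ≫ f =
      lift (fst _ _ ▷ A ≫ f) (snd _ _ ▷ A ≫ f) ≫ AddMonObj.add := by
  constructor
  · intro h
    have := h (fst (M ⊗ M) A ≫ fst _ _) (fst _ _ ≫ snd _ _) (snd _ _)
    convert! this using 1
    · congr 1
      ext
      · simp [Hom.add_def]
      · simp
    · rw [Hom.add_def]
      congr 3 <;> ext <;> simp
  · intro h T x y a
    have := lift (lift x y) a ≫= h
    simpa [Hom.add_def, comp_lift_assoc] using this

lemma isAdditiveLeft_iff_braiding {A M N : C} [AddMonObj M] [AddMonObj N] {f : M ⊗ A ⟶ N} :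
    IsAdditiveLeft f ↔ IsAdditiveRight ((β_ A M).hom ≫ f) := by
  simp [IsAdditiveLeft, IsAdditiveRight, lift_braiding_hom_assoc]
  grind

lemma IsAdditiveRight.lift_sum_comp {A M N T : C} [AddGrpObj M] [IsCommAddMonObj M]
    [AddGrpObj N] [IsCommAddMonObj N] {f : A ⊗ M ⟶ N} (hf : IsAdditiveRight f) (a : T ⟶ A)
    {ι : Type*} (s : Finset ι) (x : ι → (T ⟶ M)) :
    lift a (∑ i ∈ s, x i) ≫ f = ∑ i ∈ s, lift a (x i) ≫ f := by
  classical
  induction s using Finset.induction_on with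
  | empty =>
    have h := hf a 0 0
    rw [add_zero] at h
    simpa using h
  | insert i s hi ih => rw [Finset.sum_insert hi, Finset.sum_insert hi, hf, ih]

end Additive

/-! ### Generators of the bar construction -/

section Generators

variable {C : Type u} [Category.{v} C] [CartesianMonoidalCategory C] [BraidedCategory C]
  [MonoidalClosed C] [HasColimits C] (F : SSet.{v} ⥤ C) [F.Braided] [F.IsLeftAdjoint]

/-- The structural morphisms `M^n × F Δ^n ⟶ B M`. -/
def barι (M : AbObj C) (n : SimplexCategory) :
    power M.X n.len ⊗ (cosimplicialObject F).obj n ⟶ ((bar F).obj M).X :=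
  realizationι (cosimplicialObject F) (barSimplicialObj M.X) n

/-- The simplicial operator `M^n ⟶ M^m` of `B_• M` given by `a : [m] ⟶ [n]`. -/
def barOperator (M : AbObj C) {n m : SimplexCategory} (a : m ⟶ n) :
    power M.X n.len ⟶ power M.X m.len :=
  (barSimplicialObj M.X).map a.op

lemma barOperator_π (M : AbObj C) {n m : SimplexCategory} (a : m ⟶ n) (i : Fin m.len) :
    barOperator M a ≫ power.π M.X i = ∑ k ∈ gaps a i, power.π M.X k :=
  barSimplicialObj_map_π (A := M.X) a.op i

variable {F}

/-- The coend relation: `[a x, t] = [x, a t]`. -/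
lemma barι_condition {M : AbObj C} {T : C} {n m : SimplexCategory} (a : m ⟶ n)
    (x : T ⟶ power M.X n.len) (t : T ⟶ (cosimplicialObject F).obj m) :
    lift (x ≫ barOperator M a) t ≫ barι F M m =
      lift x (t ≫ (cosimplicialObject F).map a) ≫ barι F M n := by
  have h : barOperator M a ▷ _ ≫ barι F M m = _ ◁ (cosimplicialObject F).map a ≫ barι F M n :=
    realizationι_condition (D := cosimplicialObject F) (barSimplicialObj M.X) a
  have := lift x t ≫= h
  rwa [lift_whiskerRight_assoc, lift_whiskerLeft_assoc] at this

/-- A map out of `A × B M` is determined by its values at the points `(a, [x, t])`, because `A × -`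
preserves colimits. -/
lemma bar_lift_hom_ext {M : AbObj C} {A Q : C} {g g' : A ⊗ ((bar F).obj M).X ⟶ Q}
    (h : ∀ (T : C) (a : T ⟶ A) (n : SimplexCategory) (x : T ⟶ power M.X n.len)
      (t : T ⟶ (cosimplicialObject F).obj n),
      lift a (lift x t ≫ barι F M n) ≫ g = lift a (lift x t ≫ barι F M n) ≫ g') : g = g' := by
  refine whiskerLeft_realization_hom_ext fun n ↦ ?_
  have := h _ (fst A (power M.X n.len ⊗ (cosimplicialObject F).obj n)) n (snd _ _ ≫ fst _ _)
    (snd _ _ ≫ snd _ _)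
  rw [← comp_lift, lift_fst_snd, Category.comp_id] at this
  have e : A ◁ barι F M n = lift (fst _ _) (snd _ _ ≫ barι F M n) := by ext <;> simp
  rwa [← e] at this

lemma bar_hom_ext_of_lift {M : AbObj C} {Q : C} {g g' : ((bar F).obj M).X ⟶ Q}
    (h : ∀ (T : C) (n : SimplexCategory) (x : T ⟶ power M.X n.len)
      (t : T ⟶ (cosimplicialObject F).obj n),
      lift x t ≫ barι F M n ≫ g = lift x t ≫ barι F M n ≫ g') : g = g' :=
  realization_hom_ext fun n ↦ by simpa [barι] using! h _ n (fst _ _) (snd _ _)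

lemma lift_realizationι_map {X Y : SimplexCategoryᵒᵖ ⥤ C} (f : X ⟶ Y) {T : C}
    {n : SimplexCategory} (x : T ⟶ X.obj (op n)) (t : T ⟶ (cosimplicialObject F).obj n) :
    lift x t ≫ realizationι (cosimplicialObject F) X n ≫ (realization _).map f =
      lift (x ≫ f.app (op n)) t ≫ realizationι _ Y n := by
  rw [realizationι_map, lift_whiskerRight_assoc]

/-- Under `|X| × |Y| ≅ |X × Y|`, the point `([x, t], [y, t])` corresponds to `[(x, y), t]`. -/
lemma lift_realizationι_μ (X Y : SimplexCategoryᵒᵖ ⥤ C) {T : C}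
    {n : SimplexCategory} (x : T ⟶ X.obj (op n)) (y : T ⟶ Y.obj (op n))
    (t : T ⟶ (cosimplicialObject F).obj n) :
    lift (lift x t ≫ realizationι (cosimplicialObject F) X n)
      (lift y t ≫ realizationι (cosimplicialObject F) Y n) ≫
        Functor.LaxMonoidal.μ (realization (cosimplicialObject F)) X Y =
      lift (lift x y) t ≫ realizationι₂ _ X Y n := by
  rw [← cancel_mono (Functor.Monoidal.μIso (realization (cosimplicialObject F)) X Y).inv]
  have h₁ : realizationι₂ (cosimplicialObject F) X Y n ≫ (realization _).map (fst X Y) =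
      fst _ _ ▷ _ ≫ realizationι _ X n := realizationι_map (fst X Y) n
  have h₂ : realizationι₂ (cosimplicialObject F) X Y n ≫ (realization _).map (snd X Y) =
      snd _ _ ▷ _ ≫ realizationι _ Y n := realizationι_map (snd X Y) n
  ext <;> simp [h₁, h₂]

/-- A map out of `A × (|X| × |Y|)` is determined by its values at
`(a, [x, t], [y, t])`, where `x` and `y` are simplices of the same dimension. -/
lemma realization_pair_hom_ext {X Y : SimplexCategoryᵒᵖ ⥤ C} {A Q : C}
    {g g' : A ⊗ ((realization (cosimplicialObject F)).obj X ⊗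
      (realization (cosimplicialObject F)).obj Y) ⟶ Q}
    (h : ∀ (T : C) (a : T ⟶ A) (n : SimplexCategory) (x : T ⟶ X.obj (op n))
      (y : T ⟶ Y.obj (op n)) (t : T ⟶ (cosimplicialObject F).obj n),
      lift a (lift (lift x t ≫ realizationι _ X n) (lift y t ≫ realizationι _ Y n)) ≫ g =
      lift a (lift (lift x t ≫ realizationι _ X n) (lift y t ≫ realizationι _ Y n)) ≫ g') :
    g = g' := by
  rw [← cancel_epi (A ◁ (Functor.Monoidal.μIso (realization (cosimplicialObject F)) X Y).inv)]
  refine whiskerLeft_realization_hom_ext fun n ↦ ?_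
  have e : realizationι₂ (cosimplicialObject F) X Y n ≫
      (Functor.Monoidal.μIso (realization (cosimplicialObject F)) X Y).inv =
      lift (lift (fst _ _ ≫ fst _ _) (snd _ _) ≫ realizationι _ X n)
        (lift (fst _ _ ≫ snd _ _) (snd _ _) ≫ realizationι _ Y n) := by
    rw [Iso.comp_inv_eq, Functor.Monoidal.μIso_hom, lift_realizationι_μ]
    have e : lift (lift (fst (X.obj (op n) ⊗ Y.obj (op n)) ((cosimplicialObject F).obj n) ≫
      fst _ _) (fst _ _ ≫ snd _ _)) (snd _ _) = 𝟙 _ := by ext <;> simp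
    rw [e, Category.id_comp]
  have key : A ◁ realizationι₂ (cosimplicialObject F) X Y n ≫
      A ◁ (Functor.Monoidal.μIso (realization (cosimplicialObject F)) X Y).inv =
      lift (fst A ((X.obj (op n) ⊗ Y.obj (op n)) ⊗ (cosimplicialObject F).obj n))
        (lift (lift (snd _ _ ≫ fst _ _ ≫ fst _ _) (snd _ _ ≫ snd _ _) ≫ realizationι _ X n)
          (lift (snd _ _ ≫ fst _ _ ≫ snd _ _) (snd _ _ ≫ snd _ _) ≫ realizationι _ Y n)) := by
    refine CartesianMonoidalCategory.hom_ext _ _ ?_ ?_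
    · rw [← whiskerLeft_comp, whiskerLeft_fst, lift_fst]
    · rw [← whiskerLeft_comp, whiskerLeft_snd, lift_snd, e, comp_lift]
      congr 1 <;> rw [← Category.assoc, comp_lift]
  change A ◁ realizationι₂ (cosimplicialObject F) X Y n ≫ _ ≫ g =
    A ◁ realizationι₂ (cosimplicialObject F) X Y n ≫ _ ≫ g'
  rw [reassoc_of% key, reassoc_of% key]
  exact h _ _ _ _ _ _

/-- `B f` maps `[(x_i), t]` to `[(f (x_i)), t]`. -/
lemma barι_map {M N : AbObj C} (f : M ⟶ N) {T : C} {n : SimplexCategory}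
    (x : T ⟶ power M.X n.len) (t : T ⟶ (cosimplicialObject F).obj n) :
    lift x t ≫ barι F M n ≫ ((bar F).map f).hom =
      lift (power.lift fun i ↦ x ≫ power.π M.X i ≫ f.hom) t ≫ barι F N n := by
  refine (lift_realizationι_map (F := F) (barSimplicialMap f.hom) (n := n) x t).trans ?_
  refine congr_arg (fun y : T ⟶ power N.X n.len ↦ lift y t ≫ barι F N n) ?_
  refine power.hom_ext fun i ↦ ?_
  rw [power.lift_π]
  exact (Category.assoc _ _ _).trans (x ≫= barSimplicialMap_app_π f.hom (op n) i)

/-- `[x, t] + [y, t] = [x + y, t]`. -/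
lemma barι_add (M : AbObj C) {T : C} {n : SimplexCategory}
    (x y : T ⟶ power M.X n.len) (t : T ⟶ (cosimplicialObject F).obj n) :
    lift x t ≫ barι F M n + lift y t ≫ barι F M n =
      lift (power.lift fun i ↦ x ≫ power.π M.X i + y ≫ power.π M.X i) t ≫ barι F M n := by
  have h := lift_realizationι_μ (F := F) (barSimplicialObj M.X) (barSimplicialObj M.X)
    (n := n) x y t
  have h' := lift_realizationι_map (F := F) (barAdd M.X) (n := n)
    (show T ⟶ (barSimplicialObj M.X ⊗ barSimplicialObj M.X).obj (op n) from lift x y) t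
  have e : lift x t ≫ barι F M n + lift y t ≫ barι F M n =
      (lift (lift x t ≫ barι F M n) (lift y t ≫ barι F M n) ≫
        Functor.LaxMonoidal.μ (realization (cosimplicialObject F)) (barSimplicialObj M.X)
          (barSimplicialObj M.X)) ≫ (realization (cosimplicialObject F)).map (barAdd M.X) :=
    (Category.assoc _ _ _).symm
  refine e.trans ((congr_arg (· ≫ _) h).trans ((Category.assoc _ _ _).trans (h'.trans ?_)))
  refine congr_arg (fun y : T ⟶ power M.X n.len ↦ lift y t ≫ barι F M n) ?_
  refine power.hom_ext fun i ↦ ?_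
  rw [power.lift_π]
  refine (Category.assoc _ _ _).trans ((_ ≫= barAdd_app_π (A := M.X) (op n) i).trans ?_)
  refine (AddMonObj.comp_add _ _ _).trans ?_
  congr 1
  · exact (Category.assoc _ _ _).symm.trans (congr_arg (· ≫ _) (lift_fst x y))
  · exact (Category.assoc _ _ _).symm.trans (congr_arg (· ≫ _) (lift_snd x y))

lemma bar_pair_hom_ext {M N : AbObj C} {A Q : C}
    {g g' : A ⊗ (((bar F).obj M).X ⊗ ((bar F).obj N).X) ⟶ Q}
    (h : ∀ (T : C) (a : T ⟶ A) (n : SimplexCategory) (x : T ⟶ power M.X n.len)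
      (y : T ⟶ power N.X n.len) (t : T ⟶ (cosimplicialObject F).obj n),
      lift a (lift (lift x t ≫ barι F M n) (lift y t ≫ barι F N n)) ≫ g =
      lift a (lift (lift x t ≫ barι F M n) (lift y t ≫ barι F N n)) ≫ g') :
    g = g' :=
  realization_pair_hom_ext h

end Generators

/-! ### Extensions of pairings to the bar construction -/

section Extension

variable {C : Type u} [Category.{v} C] [CartesianMonoidalCategory C] [BraidedCategory C]

/-- The simplicial morphism `c A × B_• M ⟶ B_• N` with components
`(a, (x_i)) ↦ (f (a, x_i))`, for `f` additive in the second variable. -/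
def barPairing {A M N : C} [AddGrpObj M] [IsCommAddMonObj M] [AddGrpObj N] [IsCommAddMonObj N]
    (f : A ⊗ M ⟶ N) (hf : IsAdditiveRight f) :
    (Functor.const _).obj A ⊗ barSimplicialObj M ⟶ barSimplicialObj N where
  app p := barLift N fun i ↦ A ◁ barπ M p i ≫ f
  naturality p q a := by
    have e {n : SimplexCategoryᵒᵖ} {T : C} (x : T ⟶ (barSimplicialObj M).obj n)
        (k : Fin n.unop.len) : A ◁ x ≫ A ◁ barπ M n k =
          lift (fst _ _) (snd _ _ ≫ x ≫ barπ M n k) := by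
      ext <;> simp
    have e' {n : SimplexCategoryᵒᵖ} (k : Fin n.unop.len) : A ◁ barπ M n k =
          lift (fst _ _) (snd _ _ ≫ barπ M n k) := by
      ext <;> simp
    have h : (𝟙 A ⊗ₘ (barSimplicialObj M).map a) ≫
        (barLift N (n := q) fun i ↦ A ◁ barπ M q i ≫ f) =
          (barLift N (n := p) fun i ↦ A ◁ barπ M p i ≫ f) ≫ (barSimplicialObj N).map a := by
      refine bar_obj_hom_ext fun i ↦ ?_
      rw [Category.assoc, Category.assoc, barLift_π, barSimplicialObj_map_π, comp_sum,
        id_tensorHom, reassoc_of% e, barSimplicialObj_map_π, comp_sum, hf.lift_sum_comp]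
      exact Finset.sum_congr rfl fun k _ ↦ by rw [barLift_π, e']
    exact h

lemma barPairing_app_π {A M N : C} [AddGrpObj M] [IsCommAddMonObj M] [AddGrpObj N]
    [IsCommAddMonObj N] (f : A ⊗ M ⟶ N) (hf : IsAdditiveRight f) (p : SimplexCategoryᵒᵖ)
    (i : Fin p.unop.len) :
    (barPairing f hf).app p ≫ barπ N p i = A ◁ barπ M p i ≫ f :=
  barLift_π _ _

variable [MonoidalClosed C] [HasColimits C] (F : SSet.{v} ⥤ C) [F.Braided] [F.IsLeftAdjoint]

/-- `g : A × B M ⟶ B N` extends `f : A × M ⟶ N`: on generators,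
`g (a, [(x_i), t]) = [(f (a, x_i)), t]`. -/
def ExtendsRight {A : C} {M N : AbObj C} (f : A ⊗ M.X ⟶ N.X)
    (g : A ⊗ ((bar F).obj M).X ⟶ ((bar F).obj N).X) : Prop :=
  ∀ ⦃T : C⦄ (a : T ⟶ A) ⦃n : SimplexCategory⦄ (x : T ⟶ power M.X n.len)
    (t : T ⟶ (cosimplicialObject F).obj n), lift a (lift x t ≫ barι F M n) ≫ g =
      lift (power.lift fun i ↦ lift a (x ≫ power.π M.X i) ≫ f) t ≫ barι F N n

/-- `g : B M × A ⟶ B N` extends `f : M × A ⟶ N`: on generators,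
`g ([(x_i), t], a) = [(f (x_i, a)), t]`. -/
def ExtendsLeft {A : C} {M N : AbObj C} (f : M.X ⊗ A ⟶ N.X)
    (g : ((bar F).obj M).X ⊗ A ⟶ ((bar F).obj N).X) : Prop :=
  ∀ ⦃T : C⦄ (a : T ⟶ A) ⦃n : SimplexCategory⦄ (x : T ⟶ power M.X n.len)
    (t : T ⟶ (cosimplicialObject F).obj n), lift (lift x t ≫ barι F M n) a ≫ g =
      lift (power.lift fun i ↦ lift (x ≫ power.π M.X i) a ≫ f) t ≫ barι F N n

variable {F}

lemma extendsLeft_iff {A : C} {M N : AbObj C} {f : M.X ⊗ A ⟶ N.X}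
    {g : ((bar F).obj M).X ⊗ A ⟶ ((bar F).obj N).X} :
    ExtendsLeft F f g ↔ ExtendsRight F ((β_ _ _).hom ≫ f) ((β_ _ _).hom ≫ g) := by
  simp only [ExtendsLeft, ExtendsRight, lift_braiding_hom_assoc]

/-- The isomorphism `A × |X| ≅ |cA × X|` maps `(a, [x, t])` to `[(a, x), t]`. -/
lemma lift_tensorRealizationIso_hom {T A : C} (a : T ⟶ A) (X : SimplexCategoryᵒᵖ ⥤ C)
    {n : SimplexCategory} (x : T ⟶ X.obj (op n)) (t : T ⟶ (cosimplicialObject F).obj n) :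
    lift a (lift x t ≫ realizationι (cosimplicialObject F) X n) ≫
        (tensorRealizationIso F A X).hom =
      lift (lift a x) t ≫
        realizationι₂ (cosimplicialObject F) ((Functor.const _).obj A) X n := by
  have e : lift a t ≫ realizationι (cosimplicialObject F) ((Functor.const _).obj A) n =
      a ≫ (realizationConstIso F A).inv := by
    rw [Iso.eq_comp_inv, Category.assoc]
    refine (_ ≫= realizationι_constHom _ A n).trans ?_
    simp
  refine Eq.trans ?_ (lift_realizationι_μ (F := F)
    ((Functor.const SimplexCategoryᵒᵖ).obj A) X (n := n) a x t)
  refine Eq.trans ?_ (congr_arg (fun z ↦ lift z _ ≫ _) e).symm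
  simp [tensorRealizationIso]

lemma IsBarExtensionRight.extendsRight {A : C} {M N : AbObj C} {f : A ⊗ M.X ⟶ N.X}
    {g : A ⊗ ((bar F).obj M).X ⟶ ((bar F).obj N).X} (h : IsBarExtensionRight F f g) :
    ExtendsRight F f g := by
  obtain ⟨φ, hφ, rfl⟩ := h
  intro T a n x t
  refine (Category.assoc _ _ _).symm.trans ((congr_arg (· ≫ _)
    (lift_tensorRealizationIso_hom (F := F) a (barSimplicialObj M.X) x t)).trans
      ((Category.assoc _ _ _).trans
        ((lift_realizationι_map (F := F) φ (n := n) (lift a x) t).trans ?_)))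
  refine congr_arg (fun y : T ⟶ power N.X n.len ↦ lift y t ≫ barι F N n) ?_
  refine power.hom_ext fun i ↦ ?_
  rw [power.lift_π]
  refine (Category.assoc _ _ _).trans ((_ ≫= hφ (op n) i).trans ?_)
  exact lift_whiskerLeft_assoc _ _ _ _

lemma ExtendsRight.unique {A : C} {M N : AbObj C} {f : A ⊗ M.X ⟶ N.X}
    {g g' : A ⊗ ((bar F).obj M).X ⟶ ((bar F).obj N).X}
    (h : ExtendsRight F f g) (h' : ExtendsRight F f g') : g = g' :=
  bar_lift_hom_ext fun _ a _ x t ↦ (h a x t).trans (h' a x t).symm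

lemma ExtendsRight.isBarExtensionRight {A : C} {M N : AbObj C} {f : A ⊗ M.X ⟶ N.X}
    {g : A ⊗ ((bar F).obj M).X ⟶ ((bar F).obj N).X} (h : ExtendsRight F f g)
    (hf : IsAdditiveRight f) : IsBarExtensionRight F f g := by
  have h₁ : IsBarExtensionRight F f _ := ⟨barPairing f hf, barPairing_app_π f hf, rfl⟩
  rwa [h.unique h₁.extendsRight]

lemma exists_extendsRight {A : C} {M N : AbObj C} {f : A ⊗ M.X ⟶ N.X}
    (hf : IsAdditiveRight f) : ∃ g, ExtendsRight F f g :=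
  ⟨_, IsBarExtensionRight.extendsRight ⟨barPairing f hf, barPairing_app_π f hf, rfl⟩⟩

lemma exists_extendsLeft {A : C} {M N : AbObj C} {f : M.X ⊗ A ⟶ N.X}
    (hf : IsAdditiveLeft f) : ∃ g, ExtendsLeft F f g := by
  obtain ⟨g, hg⟩ := exists_extendsRight (F := F) (isAdditiveLeft_iff_braiding.1 hf)
  exact ⟨(β_ _ _).inv ≫ g, extendsLeft_iff.2 (by rwa [Iso.hom_inv_id_assoc])⟩

lemma isBarExtensionLeft_iff {A : C} {M N : AbObj C} {f : M.X ⊗ A ⟶ N.X}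
    {g : ((bar F).obj M).X ⊗ A ⟶ ((bar F).obj N).X} :
    IsBarExtensionLeft F f g ↔
      IsBarExtensionRight F ((β_ _ _).hom ≫ f) ((β_ _ _).hom ≫ g) := by
  have key : (β_ A ((realization (cosimplicialObject F)).obj (barSimplicialObj M.X))).hom ≫
        (realizationTensorIso F (barSimplicialObj M.X) A).hom =
      (tensorRealizationIso F A (barSimplicialObj M.X)).hom ≫
        (realization (cosimplicialObject F)).map (β_ _ _).hom := by
    simp [realizationTensorIso, tensorRealizationIso]
  have hβ (p : SimplexCategoryᵒᵖ) (i : Fin p.unop.len) :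
      (β_ A ((barSimplicialObj M.X).obj p)).hom ≫ barπ M.X p i ▷ A ≫ f =
        A ◁ barπ M.X p i ≫ (β_ _ _).hom ≫ f :=
    (BraidedCategory.braiding_naturality_right_assoc _ _ _).symm
  constructor
  · rintro ⟨φ, hφ, rfl⟩
    refine ⟨(β_ _ _).hom ≫ φ, fun p i ↦ ?_, ?_⟩
    · rw [NatTrans.comp_app, Category.assoc, hφ]
      exact hβ p i
    · rw [Functor.map_comp, ← reassoc_of% key]
      rfl
  · rintro ⟨φ, hφ, h⟩
    have e : φ = (β_ _ _).hom ≫ (β_ _ _).inv ≫ φ := (Iso.hom_inv_id_assoc _ _).symm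
    refine ⟨(β_ _ _).inv ≫ φ, fun p i ↦ ?_, ?_⟩
    · rw [NatTrans.comp_app, Category.assoc, hφ, ← hβ]
      exact Iso.inv_hom_id_assoc (β_ A ((barSimplicialObj M.X).obj p)) _
    · rw [e, Functor.map_comp, ← reassoc_of% key] at h
      exact (cancel_epi _).1 h

lemma IsBarExtensionLeft.extendsLeft {A : C} {M N : AbObj C} {f : M.X ⊗ A ⟶ N.X}
    {g : ((bar F).obj M).X ⊗ A ⟶ ((bar F).obj N).X} (h : IsBarExtensionLeft F f g) :
    ExtendsLeft F f g :=
  extendsLeft_iff.2 (isBarExtensionLeft_iff.1 h).extendsRight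

lemma ExtendsLeft.isBarExtensionLeft {A : C} {M N : AbObj C} {f : M.X ⊗ A ⟶ N.X}
    {g : ((bar F).obj M).X ⊗ A ⟶ ((bar F).obj N).X} (h : ExtendsLeft F f g)
    (hf : IsAdditiveLeft f) : IsBarExtensionLeft F f g :=
  isBarExtensionLeft_iff.2
    ((extendsLeft_iff.1 h).isBarExtensionRight (isAdditiveLeft_iff_braiding.1 hf))

/-- Two points of `B M` may be taken over the same point `t` of a simplex, where addition is
coordinatewise. -/
lemma ExtendsRight.isAdditiveRight {A : C} {M N : AbObj C} {f : A ⊗ M.X ⟶ N.X}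
    {g : A ⊗ ((bar F).obj M).X ⟶ ((bar F).obj N).X} (h : ExtendsRight F f g)
    (hf : IsAdditiveRight f) : IsAdditiveRight g := by
  rw [isAdditiveRight_iff]
  refine bar_pair_hom_ext fun T a n x y t ↦ ?_
  have e := barι_add (F := F) M x y t
  rw [Hom.add_def] at e
  rw [lift_whiskerLeft_assoc, e, h, comp_lift_assoc, lift_whiskerLeft_assoc, lift_fst,
    lift_whiskerLeft_assoc, lift_snd, h, h, ← Hom.add_def, barι_add]
  simp only [power.lift_π]
  simp only [hf a]

lemma ExtendsRight.isAdditiveLeft {A : C} [AddMonObj A] {M N : AbObj C} {f : A ⊗ M.X ⟶ N.X}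
    {g : A ⊗ ((bar F).obj M).X ⟶ ((bar F).obj N).X} (h : ExtendsRight F f g)
    (hf : IsAdditiveLeft f) : IsAdditiveLeft g := by
  rw [isAdditiveLeft_iff]
  refine bar_lift_hom_ext fun T a n x t ↦ ?_
  rw [lift_whiskerRight_assoc, h, comp_lift_assoc, lift_whiskerRight_assoc,
    lift_whiskerRight_assoc, h, h, ← Hom.add_def, barι_add]
  have e : a ≫ AddMonObj.add = a ≫ fst A A + a ≫ snd A A := by
    rw [Hom.add_def, ← comp_lift, lift_fst_snd, Category.comp_id]
  simp only [power.lift_π, e]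
  simp only [hf _ _ _]

lemma ExtendsLeft.isAdditiveLeft {A : C} {M N : AbObj C} {f : M.X ⊗ A ⟶ N.X}
    {g : ((bar F).obj M).X ⊗ A ⟶ ((bar F).obj N).X} (h : ExtendsLeft F f g)
    (hf : IsAdditiveLeft f) : IsAdditiveLeft g :=
  isAdditiveLeft_iff_braiding.2
    ((extendsLeft_iff.1 h).isAdditiveRight (isAdditiveLeft_iff_braiding.1 hf))

lemma ExtendsLeft.isAdditiveRight {A : C} [AddMonObj A] {M N : AbObj C} {f : M.X ⊗ A ⟶ N.X}
    {g : ((bar F).obj M).X ⊗ A ⟶ ((bar F).obj N).X} (h : ExtendsLeft F f g)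
    (hf : IsAdditiveRight f) : IsAdditiveRight g := by
  have hf' : IsAdditiveLeft ((β_ _ _).hom ≫ f) := fun T x y a ↦ by
    simp only [lift_braiding_hom_assoc, hf a]
  have hg := (extendsLeft_iff.1 h).isAdditiveLeft hf'
  intro T a x y
  simpa only [lift_braiding_hom_assoc] using hg x y a

end Extension

/-! ### The iterated multiplication -/

section Product

variable {C : Type u} [Category.{v} C] [CartesianMonoidalCategory C] [BraidedCategory C]
  [MonoidalClosed C] [HasColimits C] {F : SSet.{v} ⥤ C} [F.Braided] [F.IsLeftAdjoint]

lemma bar_lift_hom_ext_left {M : AbObj C} {A Q : C} {g g' : ((bar F).obj M).X ⊗ A ⟶ Q}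
    (h : ∀ (T : C) (a : T ⟶ A) (n : SimplexCategory) (x : T ⟶ power M.X n.len)
      (t : T ⟶ (cosimplicialObject F).obj n),
      lift (lift x t ≫ barι F M n) a ≫ g = lift (lift x t ≫ barι F M n) a ≫ g') : g = g' := by
  rw [← cancel_epi (β_ _ _).hom]
  refine bar_lift_hom_ext fun T a n x t ↦ ?_
  rw [lift_braiding_hom_assoc, lift_braiding_hom_assoc, h]

lemma bar_lift_hom_ext_left_left {M : AbObj C} {A A' Q : C}
    {g g' : (((bar F).obj M).X ⊗ A) ⊗ A' ⟶ Q}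
    (h : ∀ (T : C) (a : T ⟶ A) (a' : T ⟶ A') (n : SimplexCategory) (x : T ⟶ power M.X n.len)
      (t : T ⟶ (cosimplicialObject F).obj n),
      lift (lift (lift x t ≫ barι F M n) a) a' ≫ g =
        lift (lift (lift x t ≫ barι F M n) a) a' ≫ g') : g = g' := by
  rw [← cancel_epi (α_ _ _ _).inv]
  refine bar_lift_hom_ext_left fun T a n x t ↦ ?_
  have e : lift (lift x t ≫ barι F M n) a ≫ (α_ _ _ _).inv =
      lift (lift (lift x t ≫ barι F M n) (a ≫ fst _ _)) (a ≫ snd _ _) := by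
    ext <;> simp
  rw [reassoc_of% e, reassoc_of% e, h]

lemma bar_lift_hom_ext_left_right {M : AbObj C} {A A' Q : C}
    {g g' : (A ⊗ ((bar F).obj M).X) ⊗ A' ⟶ Q}
    (h : ∀ (T : C) (a : T ⟶ A) (a' : T ⟶ A') (n : SimplexCategory) (x : T ⟶ power M.X n.len)
      (t : T ⟶ (cosimplicialObject F).obj n),
      lift (lift a (lift x t ≫ barι F M n)) a' ≫ g =
        lift (lift a (lift x t ≫ barι F M n)) a' ≫ g') : g = g' := by
  rw [← cancel_epi ((β_ _ _).hom ▷ A')]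
  refine bar_lift_hom_ext_left_left fun T a a' n x t ↦ ?_
  rw [lift_whiskerRight_assoc, lift_whiskerRight_assoc, lift_braiding_hom, h]

lemma ExtendsRight.one_mul {A : C} {M : AbObj C} {e : 𝟙_ C ⟶ A} {f : A ⊗ M.X ⟶ M.X}
    {g : A ⊗ ((bar F).obj M).X ⟶ ((bar F).obj M).X} (h : ExtendsRight F f g)
    (hf : e ▷ M.X ≫ f = (λ_ _).hom) : e ▷ ((bar F).obj M).X ≫ g = (λ_ _).hom := by
  refine bar_lift_hom_ext fun T a n x t ↦ ?_
  rw [lift_whiskerRight_assoc, h, lift_leftUnitor_hom]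
  congr 2
  refine power.hom_ext fun i ↦ ?_
  have := lift a (x ≫ power.π _ i) ≫= hf
  rw [lift_whiskerRight_assoc, lift_leftUnitor_hom] at this
  rw [power.lift_π, this]

lemma ExtendsLeft.mul_one {A : C} {M : AbObj C} {e : 𝟙_ C ⟶ A} {f : M.X ⊗ A ⟶ M.X}
    {g : ((bar F).obj M).X ⊗ A ⟶ ((bar F).obj M).X} (h : ExtendsLeft F f g)
    (hf : M.X ◁ e ≫ f = (ρ_ _).hom) : ((bar F).obj M).X ◁ e ≫ g = (ρ_ _).hom := by
  refine bar_lift_hom_ext_left fun T a n x t ↦ ?_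
  rw [lift_whiskerLeft_assoc, h, lift_rightUnitor_hom]
  congr 2
  refine power.hom_ext fun i ↦ ?_
  have := lift (x ≫ power.π _ i) a ≫= hf
  rw [lift_whiskerLeft_assoc, lift_rightUnitor_hom] at this
  rw [power.lift_π, this]

/-- Associativity passes to the bar construction of the last variable. -/
lemma ExtendsRight.assoc {A A' A'' : C} {M N K : AbObj C} {c : A ⊗ A' ⟶ A''}
    {f₁ : A'' ⊗ M.X ⟶ K.X} {f₂ : A' ⊗ M.X ⟶ N.X} {f₃ : A ⊗ N.X ⟶ K.X}
    {g₁ : A'' ⊗ ((bar F).obj M).X ⟶ ((bar F).obj K).X}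
    {g₂ : A' ⊗ ((bar F).obj M).X ⟶ ((bar F).obj N).X}
    {g₃ : A ⊗ ((bar F).obj N).X ⟶ ((bar F).obj K).X}
    (h₁ : ExtendsRight F f₁ g₁) (h₂ : ExtendsRight F f₂ g₂) (h₃ : ExtendsRight F f₃ g₃)
    (h : c ▷ _ ≫ f₁ = (α_ _ _ _).hom ≫ _ ◁ f₂ ≫ f₃) :
    c ▷ _ ≫ g₁ = (α_ _ _ _).hom ≫ _ ◁ g₂ ≫ g₃ := by
  refine bar_lift_hom_ext fun T a n x t ↦ ?_
  obtain ⟨a, a', rfl⟩ : ∃ b b', a = lift b b' := ⟨a ≫ fst _ _, a ≫ snd _ _, by ext <;> simp⟩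
  rw [lift_whiskerRight_assoc, h₁, lift_lift_associator_hom_assoc, lift_whiskerLeft_assoc, h₂, h₃]
  congr 2
  refine power.hom_ext fun i ↦ ?_
  have := lift (lift a a') (x ≫ power.π _ i) ≫= h
  rw [lift_whiskerRight_assoc, lift_lift_associator_hom_assoc, lift_whiskerLeft_assoc] at this
  rw [power.lift_π, power.lift_π, power.lift_π, this]

/-- Associativity passes to the bar construction of the middle variable. -/
lemma ExtendsRight.assoc_extendsLeft {A A' : C} {M N P K : AbObj C}
    {f₁ : A ⊗ M.X ⟶ N.X} {f₂ : N.X ⊗ A' ⟶ K.X} {f₃ : M.X ⊗ A' ⟶ P.X} {f₄ : A ⊗ P.X ⟶ K.X}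
    {g₁ : A ⊗ ((bar F).obj M).X ⟶ ((bar F).obj N).X}
    {g₂ : ((bar F).obj N).X ⊗ A' ⟶ ((bar F).obj K).X}
    {g₃ : ((bar F).obj M).X ⊗ A' ⟶ ((bar F).obj P).X}
    {g₄ : A ⊗ ((bar F).obj P).X ⟶ ((bar F).obj K).X}
    (h₁ : ExtendsRight F f₁ g₁) (h₂ : ExtendsLeft F f₂ g₂) (h₃ : ExtendsLeft F f₃ g₃)
    (h₄ : ExtendsRight F f₄ g₄) (h : f₁ ▷ _ ≫ f₂ = (α_ _ _ _).hom ≫ _ ◁ f₃ ≫ f₄) :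
    g₁ ▷ _ ≫ g₂ = (α_ _ _ _).hom ≫ _ ◁ g₃ ≫ g₄ := by
  refine bar_lift_hom_ext_left_right fun T a a' n x t ↦ ?_
  rw [lift_whiskerRight_assoc, h₁, h₂, lift_lift_associator_hom_assoc, lift_whiskerLeft_assoc,
    h₃, h₄]
  congr 2
  refine power.hom_ext fun i ↦ ?_
  have := lift (lift a (x ≫ power.π _ i)) a' ≫= h
  rw [lift_whiskerRight_assoc, lift_lift_associator_hom_assoc, lift_whiskerLeft_assoc] at this
  rw [power.lift_π, power.lift_π, power.lift_π, power.lift_π, this]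

/-- Associativity passes to the bar construction of the first variable. -/
lemma ExtendsLeft.assoc {A A' A'' : C} {M N K : AbObj C} {c : A ⊗ A' ⟶ A''}
    {f₁ : M.X ⊗ A ⟶ N.X} {f₂ : N.X ⊗ A' ⟶ K.X} {f₃ : M.X ⊗ A'' ⟶ K.X}
    {g₁ : ((bar F).obj M).X ⊗ A ⟶ ((bar F).obj N).X}
    {g₂ : ((bar F).obj N).X ⊗ A' ⟶ ((bar F).obj K).X}
    {g₃ : ((bar F).obj M).X ⊗ A'' ⟶ ((bar F).obj K).X}
    (h₁ : ExtendsLeft F f₁ g₁) (h₂ : ExtendsLeft F f₂ g₂) (h₃ : ExtendsLeft F f₃ g₃)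
    (h : f₁ ▷ _ ≫ f₂ = (α_ _ _ _).hom ≫ _ ◁ c ≫ f₃) :
    g₁ ▷ _ ≫ g₂ = (α_ _ _ _).hom ≫ _ ◁ c ≫ g₃ := by
  refine bar_lift_hom_ext_left_left fun T a a' n x t ↦ ?_
  rw [lift_whiskerRight_assoc, h₁, h₂, lift_lift_associator_hom_assoc, lift_whiskerLeft_assoc, h₃]
  congr 2
  refine power.hom_ext fun i ↦ ?_
  have := lift (lift (x ≫ power.π _ i) a) a' ≫= h
  rw [lift_whiskerRight_assoc, lift_lift_associator_hom_assoc, lift_whiskerLeft_assoc] at this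
  rw [power.lift_π, power.lift_π, power.lift_π, this]

lemma ExtendsRight.naturality {A A' : C} {M N M' N' : AbObj C} {f : A ⊗ M.X ⟶ N.X}
    {g : A ⊗ ((bar F).obj M).X ⟶ ((bar F).obj N).X} (h : ExtendsRight F f g)
    {f' : A' ⊗ M'.X ⟶ N'.X} {g' : A' ⊗ ((bar F).obj M').X ⟶ ((bar F).obj N').X}
    (h' : ExtendsRight F f' g') {a : A ⟶ A'} {m : M ⟶ M'} {k : N ⟶ N'}
    (hf : f ≫ k.hom = (a ⊗ₘ m.hom) ≫ f') :
    g ≫ ((bar F).map k).hom = (a ⊗ₘ ((bar F).map m).hom) ≫ g' := by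
  refine bar_lift_hom_ext fun T b n x t ↦ ?_
  rw [← Category.assoc, h, Category.assoc, barι_map, lift_map_assoc, Category.assoc, barι_map, h']
  congr 2
  refine power.hom_ext fun i ↦ ?_
  have := lift b (x ≫ power.π _ i) ≫= hf
  rw [lift_map_assoc, Category.assoc] at this
  rw [power.lift_π, power.lift_π, power.lift_π, ← Category.assoc, power.lift_π, Category.assoc,
    this]

lemma ExtendsLeft.naturality {A A' : C} {M N M' N' : AbObj C} {f : M.X ⊗ A ⟶ N.X}
    {g : ((bar F).obj M).X ⊗ A ⟶ ((bar F).obj N).X} (h : ExtendsLeft F f g)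
    {f' : M'.X ⊗ A' ⟶ N'.X} {g' : ((bar F).obj M').X ⊗ A' ⟶ ((bar F).obj N').X}
    (h' : ExtendsLeft F f' g') {m : M ⟶ M'} {a : A ⟶ A'} {k : N ⟶ N'}
    (hf : f ≫ k.hom = (m.hom ⊗ₘ a) ≫ f') :
    g ≫ ((bar F).map k).hom = (((bar F).map m).hom ⊗ₘ a) ≫ g' := by
  rw [extendsLeft_iff] at h h'
  rw [← cancel_epi (β_ _ _).hom, ← Category.assoc, h.naturality h' (a := a) (m := m),
    BraidedCategory.braiding_naturality_assoc]
  rw [Category.assoc, hf, BraidedCategory.braiding_naturality_assoc]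

variable (F) in
/-- A system of multiplications `B^n S × B^m S ⟶ B^k S`, for `n + m = k`, that is the
multiplication of `S` in bidegree `(0, 0)` and whose other members are obtained by successive
extensions, expressed on generators. -/
structure IsBarProduct (S : RingObjCat C)
    (mul : ∀ n m k : ℕ, n + m = k → (((barIter F n).obj (ringToAb.obj S)).X ⊗
      ((barIter F m).obj (ringToAb.obj S)).X ⟶ ((barIter F k).obj (ringToAb.obj S)).X)) :
    Prop where
  zero_zero : mul 0 0 0 rfl = (MonObj.mul : S.X ⊗ S.X ⟶ S.X)
  zero_succ (m : ℕ) : ExtendsRight F (A := ((barIter F 0).obj (ringToAb.obj S)).X)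
    (M := (barIter F m).obj (ringToAb.obj S)) (N := (barIter F m).obj (ringToAb.obj S))
    (mul 0 m m (zero_add m)) (mul 0 (m + 1) (m + 1) (zero_add (m + 1)))
  succ (n m k : ℕ) (h : n + m = k) : ExtendsLeft F (M := (barIter F n).obj (ringToAb.obj S))
    (N := (barIter F k).obj (ringToAb.obj S)) (A := ((barIter F m).obj (ringToAb.obj S)).X)
    (mul n m k h) (mul (n + 1) m (k + 1) (by omega))

lemma IsBarMultiplication.isBarProduct {S : RingObjCat C}
    {R : GrRingStr ((barGraded F).obj (ringToAb.obj S))} (h : IsBarMultiplication F S R) :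
    IsBarProduct F S R.mul where
  zero_zero := h.mul_zero_zero
  zero_succ m := (h.mul_zero_succ m).extendsRight
  succ n m k hk := (h.mul_succ n m k hk).extendsLeft

namespace IsBarProduct

variable {S : RingObjCat C}
  {mul : ∀ n m k : ℕ, n + m = k → (((barIter F n).obj (ringToAb.obj S)).X ⊗
      ((barIter F m).obj (ringToAb.obj S)).X ⟶ ((barIter F k).obj (ringToAb.obj S)).X)}
  (hm : IsBarProduct F S mul)

include hm

lemma one_mul (n : ℕ) :
    (show 𝟙_ C ⟶ ((barIter F 0).obj (ringToAb.obj S)).X from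
      (MonObj.one : 𝟙_ C ⟶ S.X)) ▷ ((barIter F n).obj (ringToAb.obj S)).X ≫
      mul 0 n n (zero_add n) = (λ_ _).hom := by
  induction n with
  | zero =>
    rw [hm.zero_zero]
    exact MonObj.one_mul S.X
  | succ n ih => exact (hm.zero_succ n).one_mul ih

lemma mul_one (n : ℕ) :
    ((barIter F n).obj (ringToAb.obj S)).X ◁
      (show 𝟙_ C ⟶ ((barIter F 0).obj (ringToAb.obj S)).X from
        (MonObj.one : 𝟙_ C ⟶ S.X)) ≫ mul n 0 n (add_zero n) = (ρ_ _).hom := by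
  induction n with
  | zero =>
    rw [hm.zero_zero]
    exact MonObj.mul_one S.X
  | succ n ih => exact (hm.succ n 0 n (add_zero n)).mul_one ih

/-- By induction on `n`, then `m`, then `l`: the successor steps are the three ways in which
associativity passes to the bar construction. -/
lemma mul_assoc (n m l nm ml k : ℕ) (h₁ : n + m = nm) (h₂ : m + l = ml) (h₃ : nm + l = k)
    (h₄ : n + ml = k) :
    mul n m nm h₁ ▷ _ ≫ mul nm l k h₃ =
      (α_ _ _ _).hom ≫ _ ◁ mul m l ml h₂ ≫ mul n ml k h₄ := by
  induction n generalizing nm k with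
  | succ n ih =>
    obtain ⟨nm, rfl⟩ : ∃ j, nm = j + 1 := ⟨n + m, by omega⟩
    obtain ⟨k, rfl⟩ : ∃ j, k = j + 1 := ⟨n + ml, by omega⟩
    exact (hm.succ n m nm (by omega)).assoc (hm.succ nm l k (by omega))
      (hm.succ n ml k (by omega)) (ih nm k (by omega) (by omega) (by omega))
  | zero =>
    obtain rfl : m = nm := by omega
    obtain rfl : ml = k := by omega
    induction m generalizing ml with
    | succ m ih =>
      obtain ⟨ml, rfl⟩ : ∃ j, ml = j + 1 := ⟨m + l, by omega⟩
      exact (hm.zero_succ m).assoc_extendsLeft (hm.succ m l ml (by omega))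
        (hm.succ m l ml (by omega)) (hm.zero_succ ml)
        (ih ml (by omega) (by omega) (by omega) (by omega))
    | zero =>
      obtain rfl : l = ml := by omega
      induction l with
      | succ l ih =>
        exact (hm.zero_succ l).assoc (hm.zero_succ l) (hm.zero_succ l)
          (ih (by omega) (by omega) (by omega))
      | zero =>
        rw [hm.zero_zero]
        exact MonObj.mul_assoc S.X

lemma naturality {S' : RingObjCat C}
    {mul' : ∀ n m k : ℕ, n + m = k → (((barIter F n).obj (ringToAb.obj S')).X ⊗
      ((barIter F m).obj (ringToAb.obj S')).X ⟶ ((barIter F k).obj (ringToAb.obj S')).X)}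
    (hm' : IsBarProduct F S' mul') (f : S ⟶ S') (n m k : ℕ) (h : n + m = k) :
    mul n m k h ≫ ((barIter F k).map (ringToAb.map f)).hom =
      (((barIter F n).map (ringToAb.map f)).hom ⊗ₘ
        ((barIter F m).map (ringToAb.map f)).hom) ≫ mul' n m k h := by
  induction n generalizing k with
  | succ n ih =>
    obtain ⟨k, rfl⟩ : ∃ j, k = j + 1 := ⟨n + m, by omega⟩
    exact (hm.succ n m k (by omega)).naturality (hm'.succ n m k (by omega)) (ih k (by omega))
  | zero =>
    obtain rfl : m = k := by omega
    induction m with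
    | succ m ih => exact (hm.zero_succ m).naturality (hm'.zero_succ m) (ih (by omega))
    | zero =>
      rw [hm.zero_zero, hm'.zero_zero]
      exact IsMonHom.mul_hom f.hom

end IsBarProduct

/-! ### The graded ring of a ring object -/

variable (F) (S : RingObjCat C)

/-- The multiplication `S × B^m S ⟶ B^m S`, with its additivity in both variables, which the
next extension needs. -/
def barMulZero : ∀ m : ℕ, {f : S.X ⊗ ((barIter F m).obj (ringToAb.obj S)).X ⟶
    ((barIter F m).obj (ringToAb.obj S)).X // IsAdditiveRight f ∧ IsAdditiveLeft f}
  | 0 => ⟨(MonObj.mul : S.X ⊗ S.X ⟶ S.X), isAdditiveRight_iff.2 (RingObj.mul_add S.X),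
      isAdditiveLeft_iff.2 (RingObj.add_mul S.X)⟩
  | m + 1 =>
    have h := (exists_extendsRight (F := F) (barMulZero m).2.1).choose_spec
    ⟨_, h.isAdditiveRight (barMulZero m).2.1, h.isAdditiveLeft (barMulZero m).2.2⟩

/-- The multiplication `B^n S × B^m S ⟶ B^k S` for `n + m = k`, with its additivity in both
variables, which the next extension needs. -/
def barMul : ∀ n m k : ℕ, n + m = k → {f : ((barIter F n).obj (ringToAb.obj S)).X ⊗
    ((barIter F m).obj (ringToAb.obj S)).X ⟶ ((barIter F k).obj (ringToAb.obj S)).X //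
      IsAdditiveRight f ∧ IsAdditiveLeft f}
  | 0, m, k, h => ((zero_add m).symm.trans h) ▸ barMulZero F S m
  | _ + 1, _, 0, h => absurd h (by omega)
  | n + 1, m, k + 1, h =>
    have h' := (exists_extendsLeft (F := F) (barMul n m k (by omega)).2.2).choose_spec
    ⟨_, h'.isAdditiveRight (barMul n m k (by omega)).2.1,
      h'.isAdditiveLeft (barMul n m k (by omega)).2.2⟩

lemma isBarProduct_barMul : IsBarProduct F S fun n m k h ↦ (barMul F S n m k h).1 where
  zero_zero := by
    rw [barMul, barMulZero]
  zero_succ m := by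
    have h := (exists_extendsRight (F := F) (barMulZero F S m).2.1).choose_spec
    rw [barMul, barMul]
    exact h
  succ n m k h :=
    (exists_extendsLeft (F := F) (barMul F S n m k (by omega)).2.2).choose_spec

/-- The graded ring structure on `B^* S`. -/
def barGrRingStr : GrRingStr ((barGraded F).obj (ringToAb.obj S)) where
  one := (MonObj.one : 𝟙_ C ⟶ S.X)
  mul n m k h := (barMul F S n m k h).1
  one_mul n := (isBarProduct_barMul F S).one_mul n
  mul_one n := (isBarProduct_barMul F S).mul_one n
  mul_assoc n m l nm ml k h₁ h₂ h₃ h₄ :=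
    (isBarProduct_barMul F S).mul_assoc n m l nm ml k h₁ h₂ h₃ h₄
  mul_add n m k h := isAdditiveRight_iff.1 (barMul F S n m k h).2.1
  add_mul n m k h := isAdditiveLeft_iff.1 (barMul F S n m k h).2.2

lemma isBarMultiplication_barGrRingStr : IsBarMultiplication F S (barGrRingStr F S) where
  one := rfl
  mul_zero_zero := (isBarProduct_barMul F S).zero_zero
  mul_zero_succ m := ((isBarProduct_barMul F S).zero_succ m).isBarExtensionRight
    (barMul F S 0 m m (zero_add m)).2.1
  mul_succ n m k h := ((isBarProduct_barMul F S).succ n m k h).isBarExtensionLeft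
    (barMul F S n m k h).2.2

/-- The functor `B^*` on ring objects, as a lift of `B^*` on abelian group objects. -/
def barGrRingLift : GrRingLift (ringToAb (C := C) ⋙ barGraded F) where
  str S := barGrRingStr F S
  isGrRingHom {S S'} f :=
    { map_one := IsMonHom.one_hom f.hom
      map_mul n m k h :=
        (isBarProduct_barMul F S).naturality (isBarProduct_barMul F S') f n m k h }

end Product

/-! ### Base change of the bar construction -/

section BaseChange

variable {C : Type u} [Category.{v} C] [CartesianMonoidalCategory C] [BraidedCategory C]
  {D : Type u'} [Category.{v} D] [CartesianMonoidalCategory D] [BraidedCategory D]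
  (G : C ⥤ D) [G.Braided]

lemma map_sum {P : C} (M : AbObj C) {ι : Type*} (s : Finset ι) (x : ι → (P ⟶ M.X)) :
    (show G.obj P ⟶ ((mapAb G).obj M).X from G.map (∑ i ∈ s, x i)) =
      ∑ i ∈ s, (show G.obj P ⟶ ((mapAb G).obj M).X from G.map (x i)) := by
  classical
  induction s using Finset.induction_on with
  | empty => exact Functor.map_zero' G
  | insert i s hi ih =>
    rw [Finset.sum_insert hi, Finset.sum_insert hi, ← ih]
    exact Functor.map_add' G _ _

/-- The morphism `G P ⟶ (G M)^n` induced by `x : P ⟶ M^n`. -/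
def mapPower {P : C} {M : AbObj C} {n : ℕ} (x : P ⟶ power M.X n) :
    G.obj P ⟶ power ((mapAb G).obj M).X n :=
  power.lift fun i ↦ (show G.obj P ⟶ ((mapAb G).obj M).X from G.map (x ≫ power.π M.X i))

variable {G}

lemma mapPower_π {P : C} {M : AbObj C} {n : ℕ} (x : P ⟶ power M.X n) (i : Fin n) :
    mapPower G x ≫ power.π ((mapAb G).obj M).X i = G.map (x ≫ power.π M.X i) :=
  power.lift_π _ _

lemma map_comp_mapPower {P P' : C} {M : AbObj C} {n : ℕ} (y : P' ⟶ P) (x : P ⟶ power M.X n) :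
    G.map y ≫ mapPower G x = mapPower G (y ≫ x) := by
  refine power.hom_ext fun i ↦ ?_
  rw [Category.assoc, mapPower_π, mapPower_π, Category.assoc]
  exact (G.map_comp _ _).symm

/-- `G` preserves finite powers. -/
instance isIso_mapPower_id {M : AbObj C} {n : ℕ} :
    IsIso (mapPower G (𝟙 (power M.X n))) := by
  have e : mapPower G (𝟙 (power M.X n)) =
      Limits.piComparison G (fun _ : Fin n ↦ M.X) := by
    refine power.hom_ext fun i ↦ ?_
    rw [mapPower_π, Category.id_comp]
    exact (Limits.piComparison_comp_π G _ i).symm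
  rw [e]
  exact inferInstanceAs (IsIso (Limits.piComparison G (fun _ : Fin n ↦ M.X)))

variable [MonoidalClosed C] [HasColimits C] [MonoidalClosed D] [HasColimits D]
  (F : SSet.{v} ⥤ C) [F.Braided] [F.IsLeftAdjoint] [G.IsLeftAdjoint]

variable (G) in
/-- The morphism `G P ⟶ G F Δ^n` induced by `t : P ⟶ F Δ^n`. -/
def mapSimplex {P : C} {n : SimplexCategory} (t : P ⟶ (cosimplicialObject F).obj n) :
    G.obj P ⟶ (cosimplicialObject (F ⋙ G)).obj n :=
  G.map t

variable {F}

lemma map_comp_mapSimplex {P P' : C} {n : SimplexCategory} (y : P' ⟶ P)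
    (t : P ⟶ (cosimplicialObject F).obj n) :
    G.map y ≫ mapSimplex G F t = mapSimplex G F (y ≫ t) :=
  (G.map_comp y t).symm

instance isIso_mapSimplex_id (n : SimplexCategory) :
    IsIso (mapSimplex G F (𝟙 ((cosimplicialObject F).obj n))) :=
  inferInstanceAs (IsIso (G.map (𝟙 ((cosimplicialObject F).obj n))))

lemma mapSimplex_comp_map {P : C} {n m : SimplexCategory} (t : P ⟶ (cosimplicialObject F).obj n)
    (a : n ⟶ m) : mapSimplex G F t ≫ (cosimplicialObject (F ⋙ G)).map a =
      mapSimplex G F (t ≫ (cosimplicialObject F).map a) :=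
  (G.map_comp t _).symm

lemma mapPower_comp_barOperator {P : C} {M : AbObj C} {n m : SimplexCategory}
    (x : P ⟶ power M.X n.len) (a : m ⟶ n) :
    mapPower G x ≫ barOperator ((mapAb G).obj M) a = mapPower G (x ≫ barOperator M a) := by
  refine power.hom_ext fun i ↦ ?_
  rw [mapPower_π, Category.assoc, Category.assoc, barOperator_π, barOperator_π, comp_sum, comp_sum]
  exact (Finset.sum_congr rfl fun k _ ↦ mapPower_π x k).trans (map_sum G M _ _).symm

lemma mapPower_comp_inv {P : C} {M : AbObj C} {n : ℕ} (x : P ⟶ power M.X n) :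
    mapPower G x ≫ inv (mapPower G (𝟙 (power M.X n))) = G.map x := by
  rw [IsIso.comp_inv_eq, map_comp_mapPower, Category.comp_id]

lemma mapSimplex_comp_inv {P : C} {n : SimplexCategory}
    (t : P ⟶ (cosimplicialObject F).obj n) :
    mapSimplex G F t ≫ inv (mapSimplex G F (𝟙 ((cosimplicialObject F).obj n))) = G.map t := by
  rw [IsIso.comp_inv_eq, map_comp_mapSimplex, Category.comp_id]

/-- Every point of `G A × ((G M)^k × G F Δ^n)` is the restriction, along some `w`, of the image
under `G` of a point of `A × (M^k × F Δ^n)`: the universal point will do. -/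
lemma exists_eq_comp_map {T : D} {A : C} {M : AbObj C} {k : ℕ} {n : SimplexCategory}
    (a : T ⟶ G.obj A) (x : T ⟶ power ((mapAb G).obj M).X k)
    (t : T ⟶ (cosimplicialObject (F ⋙ G)).obj n) :
    ∃ (P : C) (w : T ⟶ G.obj P) (a₀ : P ⟶ A) (x₀ : P ⟶ power M.X k)
      (t₀ : P ⟶ (cosimplicialObject F).obj n),
      a = w ≫ G.map a₀ ∧ x = w ≫ mapPower G x₀ ∧ t = w ≫ mapSimplex G F t₀ := by
  refine ⟨A ⊗ (power M.X k ⊗ (cosimplicialObject F).obj n),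
    lift a (lift (x ≫ inv (mapPower G (𝟙 _))) (t ≫ inv (mapSimplex G F (𝟙 _))) ≫
      Functor.LaxMonoidal.μ G _ _) ≫ Functor.LaxMonoidal.μ G _ _,
    fst _ _, snd _ _ ≫ fst _ _, snd _ _ ≫ snd _ _, ?_, ?_, ?_⟩
  · simp
  · rw [← Category.comp_id (snd _ _ ≫ fst _ _), ← map_comp_mapPower]
    simp
  · rw [← Category.comp_id (snd _ _ ≫ snd _ _), ← map_comp_mapSimplex]
    simp

lemma power_tensor_simplex_hom_ext {M : AbObj C} {k : ℕ} {n : SimplexCategory} {Q : D}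
    {g g' : power ((mapAb G).obj M).X k ⊗ (cosimplicialObject (F ⋙ G)).obj n ⟶ Q}
    (h : ∀ (P : C) (x : P ⟶ power M.X k) (t : P ⟶ (cosimplicialObject F).obj n),
      lift (mapPower G x) (mapSimplex G F t) ≫ g =
        lift (mapPower G x) (mapSimplex G F t) ≫ g') : g = g' := by
  obtain ⟨P, w, -, x, t, -, hx, ht⟩ := exists_eq_comp_map (G := G) (F := F)
    (toUnit _ ≫ Functor.LaxMonoidal.ε G) (fst (power ((mapAb G).obj M).X k)
      ((cosimplicialObject (F ⋙ G)).obj n)) (snd _ _)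
  have e := comp_lift w (mapPower G x) (mapSimplex G F t)
  rw [← hx, ← ht, lift_fst_snd] at e
  rw [← Category.id_comp g, ← Category.id_comp g', ← e, Category.assoc, Category.assoc, h]

/-- A map out of `G A × B (G M)` is determined by its values on images under `G` of points. -/
lemma bar_map_lift_hom_ext {A : C} {M : AbObj C} {Q : D}
    {g g' : G.obj A ⊗ ((bar (F ⋙ G)).obj ((mapAb G).obj M)).X ⟶ Q}
    (h : ∀ (P : C) (a : P ⟶ A) (n : SimplexCategory) (x : P ⟶ power M.X n.len)
      (t : P ⟶ (cosimplicialObject F).obj n),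
      lift (G.map a) (lift (mapPower G x) (mapSimplex G F t) ≫ barι (F ⋙ G) _ n) ≫ g =
      lift (G.map a) (lift (mapPower G x) (mapSimplex G F t) ≫ barι (F ⋙ G) _ n) ≫ g') :
    g = g' := by
  refine bar_lift_hom_ext fun T a n x t ↦ ?_
  obtain ⟨P, w, a, x, t, rfl, rfl, rfl⟩ := exists_eq_comp_map a x t
  rw [← comp_lift, Category.assoc, ← comp_lift, Category.assoc, Category.assoc, h]

lemma bar_map_hom_ext {M : AbObj C} {Q : D}
    {g g' : ((bar (F ⋙ G)).obj ((mapAb G).obj M)).X ⟶ Q}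
    (h : ∀ (P : C) (n : SimplexCategory) (x : P ⟶ power M.X n.len)
      (t : P ⟶ (cosimplicialObject F).obj n),
      lift (mapPower G x) (mapSimplex G F t) ≫ barι (F ⋙ G) _ n ≫ g =
      lift (mapPower G x) (mapSimplex G F t) ≫ barι (F ⋙ G) _ n ≫ g') :
    g = g' := by
  refine bar_hom_ext_of_lift fun T n x t ↦ ?_
  obtain ⟨P, w, a, x, t, -, rfl, rfl⟩ :=
    exists_eq_comp_map (toUnit T ≫ Functor.LaxMonoidal.ε G) x t
  rw [← comp_lift, Category.assoc, Category.assoc, h]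

lemma bar_map_pair_hom_ext {M : AbObj C} {Q : D}
    {g g' : ((bar (F ⋙ G)).obj ((mapAb G).obj M)).X ⊗
      ((bar (F ⋙ G)).obj ((mapAb G).obj M)).X ⟶ Q}
    (h : ∀ (P : C) (n : SimplexCategory) (x y : P ⟶ power M.X n.len)
      (t : P ⟶ (cosimplicialObject F).obj n),
      lift (lift (mapPower G x) (mapSimplex G F t) ≫ barι (F ⋙ G) _ n)
        (lift (mapPower G y) (mapSimplex G F t) ≫ barι (F ⋙ G) _ n) ≫ g =
      lift (lift (mapPower G x) (mapSimplex G F t) ≫ barι (F ⋙ G) _ n)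
        (lift (mapPower G y) (mapSimplex G F t) ≫ barι (F ⋙ G) _ n) ≫ g') :
    g = g' := by
  rw [← cancel_epi (λ_ _).hom]
  refine bar_pair_hom_ext fun T a n x y t ↦ ?_
  rw [lift_leftUnitor_hom_assoc, lift_leftUnitor_hom_assoc]
  obtain ⟨P, w, a, x, t, hy, rfl, rfl⟩ :=
    exists_eq_comp_map (M := M) (y ≫ inv (mapPower G (𝟙 _))) x t
  obtain rfl : y = w ≫ mapPower G a := by
    rw [← Category.comp_id a, ← map_comp_mapPower, ← Category.assoc, ← hy]
    simp
  rw [← comp_lift, Category.assoc, ← comp_lift, Category.assoc, ← comp_lift, Category.assoc,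
    Category.assoc, h]

/-- `G` preserves the coend `|X|`, being a left adjoint: uniqueness of maps out of `G |X|`. -/
lemma map_realization_hom_ext {X : SimplexCategoryᵒᵖ ⥤ C} {T : D}
    {f g : G.obj ((realization (cosimplicialObject F)).obj X) ⟶ T}
    (h : ∀ n, G.map (realizationι _ X n) ≫ f = G.map (realizationι _ X n) ≫ g) : f = g := by
  apply ((Adjunction.ofIsLeftAdjoint G).homEquiv _ _).injective
  apply realization_hom_ext
  intro n
  rw [← Adjunction.homEquiv_naturality_left, ← Adjunction.homEquiv_naturality_left, h]

/-- `G` preserves the coend `|X|`, being a left adjoint: existence of maps out of `G |X|`. -/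
lemma exists_map_realization_desc {X : SimplexCategoryᵒᵖ ⥤ C} {T : D}
    (f : ∀ n : SimplexCategory, G.obj (X.obj (op n) ⊗ (cosimplicialObject F).obj n) ⟶ T)
    (hf : ∀ {n m : SimplexCategory} (a : n ⟶ m), G.map (X.map a.op ▷ _) ≫ f n =
      G.map (X.obj (op m) ◁ (cosimplicialObject F).map a) ≫ f m) :
    ∃ g : G.obj ((realization (cosimplicialObject F)).obj X) ⟶ T,
      ∀ n, G.map (realizationι _ X n) ≫ g = f n := by
  let adj := Adjunction.ofIsLeftAdjoint G
  refine ⟨(adj.homEquiv _ _).symm (realizationDesc (fun n ↦ adj.homEquiv _ _ (f n)) ?_),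
    fun n ↦ ?_⟩
  · intro n m a
    rw [← Adjunction.homEquiv_naturality_left, ← Adjunction.homEquiv_naturality_left, hf]
  · apply (adj.homEquiv _ _).injective
    rw [Adjunction.homEquiv_naturality_left, Equiv.apply_symm_apply, realizationι_desc]

lemma map_bar_hom_ext {M : AbObj C} {T : D} {f g : G.obj ((bar F).obj M).X ⟶ T}
    (h : ∀ (P : C) (n : SimplexCategory) (x : P ⟶ power M.X n.len)
      (t : P ⟶ (cosimplicialObject F).obj n),
      G.map (lift x t ≫ barι F M n) ≫ f = G.map (lift x t ≫ barι F M n) ≫ g) : f = g := by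
  refine map_realization_hom_ext fun n ↦ ?_
  have := h _ n (fst _ _) (snd _ _)
  rwa [lift_fst_snd, Category.id_comp] at this

/-- The comparison morphism `B (G M) ⟶ G (B M)` exists: on generators it is
`[G x, G t] ↦ G [x, t]`. -/
lemma exists_barComparison (M : AbObj C) :
    ∃ θ : ((bar (F ⋙ G)).obj ((mapAb G).obj M)).X ⟶ G.obj ((bar F).obj M).X,
      ∀ (P : C) (n : SimplexCategory) (x : P ⟶ power M.X n.len)
        (t : P ⟶ (cosimplicialObject F).obj n),
        lift (mapPower G x) (mapSimplex G F t) ≫ barι (F ⋙ G) _ n ≫ θ =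
          G.map (lift x t ≫ barι F M n) := by
  let f (n : SimplexCategory) : power ((mapAb G).obj M).X n.len ⊗
      (cosimplicialObject (F ⋙ G)).obj n ⟶ G.obj ((bar F).obj M).X :=
    (inv (mapPower G (𝟙 (power M.X n.len))) ⊗ₘ
      inv (mapSimplex G F (𝟙 ((cosimplicialObject F).obj n)))) ≫
      Functor.LaxMonoidal.μ G _ _ ≫ G.map (barι F M n)
  have hf (P : C) (n : SimplexCategory) (x : P ⟶ power M.X n.len)
      (t : P ⟶ (cosimplicialObject F).obj n) :
      lift (mapPower G x) (mapSimplex G F t) ≫ f n = G.map (lift x t ≫ barι F M n) := by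
    dsimp only [f]
    rw [lift_map_assoc, mapPower_comp_inv, mapSimplex_comp_inv, Functor.Monoidal.lift_μ_assoc,
      ← Functor.map_comp]
  have hf' {n m : SimplexCategory} (a : n ⟶ m) : barOperator ((mapAb G).obj M) a ▷ _ ≫ f n =
      _ ◁ (cosimplicialObject (F ⋙ G)).map a ≫ f m := by
    refine power_tensor_simplex_hom_ext fun P x t ↦ ?_
    rw [lift_whiskerRight_assoc, lift_whiskerLeft_assoc, mapPower_comp_barOperator,
      mapSimplex_comp_map, hf, hf, barι_condition]
  refine ⟨realizationDesc (D := cosimplicialObject (F ⋙ G))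
    (X := barSimplicialObj ((mapAb G).obj M).X) f hf', fun P n x t ↦ ?_⟩
  refine (_ ≫= realizationι_desc (D := cosimplicialObject (F ⋙ G))
    (X := barSimplicialObj ((mapAb G).obj M).X) f hf' n).trans ?_
  exact hf P n x t

/-- The inverse comparison morphism `G (B M) ⟶ B (G M)` exists. -/
lemma exists_barComparisonInv (M : AbObj C) :
    ∃ θ : G.obj ((bar F).obj M).X ⟶ ((bar (F ⋙ G)).obj ((mapAb G).obj M)).X,
      ∀ (P : C) (n : SimplexCategory) (x : P ⟶ power M.X n.len)
        (t : P ⟶ (cosimplicialObject F).obj n),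
        G.map (lift x t ≫ barι F M n) ≫ θ =
          lift (mapPower G x) (mapSimplex G F t) ≫ barι (F ⋙ G) _ n := by
  let f (n : SimplexCategory) : G.obj (power M.X n.len ⊗ (cosimplicialObject F).obj n) ⟶
      ((bar (F ⋙ G)).obj ((mapAb G).obj M)).X :=
    lift (mapPower G (fst _ _)) (mapSimplex G F (snd _ _)) ≫ barι (F ⋙ G) _ n
  have hf {n m : SimplexCategory} (a : n ⟶ m) : G.map (barOperator M a ▷ _) ≫ f n =
      G.map (_ ◁ (cosimplicialObject F).map a) ≫ f m := by
    dsimp only [f]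
    rw [← Category.assoc, ← Category.assoc, comp_lift, comp_lift]
    simp only [map_comp_mapPower, map_comp_mapSimplex, whiskerRight_fst, whiskerRight_snd,
      whiskerLeft_fst, whiskerLeft_snd]
    rw [← mapPower_comp_barOperator, ← mapSimplex_comp_map, barι_condition]
  obtain ⟨θ, hθ⟩ := exists_map_realization_desc (G := G) (F := F) (X := barSimplicialObj M.X) f hf
  refine ⟨θ, fun P n x t ↦ ?_⟩
  have key : G.map (lift x t) ≫ f n =
      lift (mapPower G x) (mapSimplex G F t) ≫ barι (F ⋙ G) _ n := by
    dsimp only [f]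
    rw [← Category.assoc, comp_lift, map_comp_mapPower, map_comp_mapSimplex, lift_fst, lift_snd]
  exact (G.map_comp_assoc _ _ _).trans ((_ ≫= hθ n).trans key)

lemma exists_barComparisonIso (M : AbObj C) :
    ∃ θ : ((bar (F ⋙ G)).obj ((mapAb G).obj M)).X ≅ G.obj ((bar F).obj M).X,
      ∀ (P : C) (n : SimplexCategory) (x : P ⟶ power M.X n.len)
        (t : P ⟶ (cosimplicialObject F).obj n),
        lift (mapPower G x) (mapSimplex G F t) ≫ barι (F ⋙ G) _ n ≫ θ.hom =
          G.map (lift x t ≫ barι F M n) := by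
  obtain ⟨θ, h⟩ := exists_barComparison (G := G) (F := F) M
  obtain ⟨θ', h'⟩ := exists_barComparisonInv (G := G) (F := F) M
  refine ⟨⟨θ, θ', bar_map_hom_ext fun P n x t ↦ ?_, map_bar_hom_ext fun P n x t ↦ ?_⟩, h⟩
  · rw [reassoc_of% h, h', Category.comp_id]
  · rw [reassoc_of% h', h, Category.comp_id]

variable (G F) in
/-- The isomorphism `B (G M) ≅ G (B M)` on underlying objects. -/
def barComparison (M : AbObj C) :
    ((bar (F ⋙ G)).obj ((mapAb G).obj M)).X ≅ G.obj ((bar F).obj M).X :=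
  (exists_barComparisonIso (G := G) (F := F) M).choose

/-- The comparison isomorphism is `[G x, G t] ↦ G [x, t]`. -/
lemma barι_barComparison {M : AbObj C} {P : C} {n : SimplexCategory} (x : P ⟶ power M.X n.len)
    (t : P ⟶ (cosimplicialObject F).obj n) :
    lift (mapPower G x) (mapSimplex G F t) ≫ barι (F ⋙ G) _ n ≫ (barComparison G F M).hom =
      G.map (lift x t ≫ barι F M n) :=
  (exists_barComparisonIso (G := G) (F := F) M).choose_spec P n x t

/-- A morphism of additive group objects that is compatible with addition is compatible with
zero. -/
lemma isAddMonHom_of_add {X Y : D} [AddGrpObj X] [AddGrpObj Y] (f : X ⟶ Y)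
    (h : AddMonObj.add ≫ f = (f ⊗ₘ f) ≫ AddMonObj.add) : IsAddMonHom f where
  add_hom := h
  zero_hom := by
    have h₀ : (0 : 𝟙_ D ⟶ X) ≫ f = (0 : 𝟙_ D ⟶ X) ≫ f + (0 : 𝟙_ D ⟶ X) ≫ f := by
      conv_lhs => rw [← add_zero (0 : 𝟙_ D ⟶ X), Hom.add_def, Category.assoc, h, lift_map_assoc,
        ← Hom.add_def]
    rw [AddMonObj.zero_eq_zero, AddMonObj.zero_eq_zero]
    simpa using h₀

instance isAddMonHom_barComparison (M : AbObj C) :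
    IsAddMonHom (barComparison G F M).hom := by
  refine isAddMonHom_of_add _ (bar_map_pair_hom_ext fun P n x y t ↦ ?_)
  rw [lift_map_assoc, Category.assoc, Category.assoc, barι_barComparison, barι_barComparison,
    ← Hom.add_def, ← Functor.map_add', barι_add, ← barι_barComparison]
  have e := barι_add (F := F ⋙ G) ((mapAb G).obj M) (mapPower G x) (mapPower G y)
    (mapSimplex G F t)
  rw [Hom.add_def] at e
  rw [reassoc_of% e]
  congr 2
  refine power.hom_ext fun i ↦ ?_
  rw [power.lift_π, mapPower_π, mapPower_π, mapPower_π, power.lift_π]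
  exact (Functor.map_add' G _ _).symm

/-- An isomorphism of underlying objects that is additive is an isomorphism of abelian group
objects. -/
def AbObj.isoOfIsAddMonHom {M N : AbObj D} (e : M.X ≅ N.X) (h : IsAddMonHom e.hom) : M ≅ N where
  hom := { hom := e.hom }
  inv := { hom := e.inv }
  hom_inv_id := AbObj.hom_ext e.hom_inv_id
  inv_hom_id := AbObj.hom_ext e.inv_hom_id

variable (G F) in
/-- The isomorphism `B (G M) ≅ G (B M)` of abelian group objects. -/
def barComparisonAb (M : AbObj C) :
    (bar (F ⋙ G)).obj ((mapAb G).obj M) ≅ (mapAb G).obj ((bar F).obj M) :=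
  AbObj.isoOfIsAddMonHom (N := (mapAb G).obj ((bar F).obj M)) (barComparison G F M)
    (isAddMonHom_barComparison M)

lemma barComparison_naturality {M N : AbObj C} (f : M ⟶ N) :
    ((bar (F ⋙ G)).map ((mapAb G).map f)).hom ≫ (barComparison G F N).hom =
      (barComparison G F M).hom ≫ G.map ((bar F).map f).hom := by
  refine bar_map_hom_ext fun P n x t ↦ ?_
  have e : (power.lift fun i ↦ mapPower G x ≫ power.π ((mapAb G).obj M).X i ≫
      ((mapAb G).map f).hom) = mapPower G (power.lift fun i ↦ x ≫ power.π M.X i ≫ f.hom) := by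
    refine power.hom_ext fun i ↦ ?_
    rw [power.lift_π, mapPower_π, power.lift_π, ← Category.assoc, mapPower_π, ← Category.assoc x]
    exact (G.map_comp _ _).symm
  have h := barι_map (F := F ⋙ G) ((mapAb G).map f) (mapPower G x) (mapSimplex G F t)
  have h' := barι_barComparison (G := G) (F := F) x t
  rw [reassoc_of% h, e, barι_barComparison, reassoc_of% h', ← Functor.map_comp,
    Category.assoc, barι_map]

/-- The comparison isomorphisms carry the extension of `G A × G M ⟶ G (A × M) ⟶ G N` to the image
under `G` of the extension of `q : A × M ⟶ N`. -/
lemma ExtendsRight.comp_barComparison {A : C} {M N : AbObj C} {q : A ⊗ M.X ⟶ N.X}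
    {q' : A ⊗ ((bar F).obj M).X ⟶ ((bar F).obj N).X} (h : ExtendsRight F q q')
    {p : G.obj A ⊗ ((mapAb G).obj M).X ⟶ ((mapAb G).obj N).X}
    {p' : G.obj A ⊗ ((bar (F ⋙ G)).obj ((mapAb G).obj M)).X ⟶
      ((bar (F ⋙ G)).obj ((mapAb G).obj N)).X} (h' : ExtendsRight (F ⋙ G) p p')
    (hp : p = Functor.LaxMonoidal.μ G A M.X ≫ G.map q) :
    p' ≫ (barComparison G F N).hom =
      G.obj A ◁ (barComparison G F M).hom ≫ Functor.LaxMonoidal.μ G _ _ ≫ G.map q' := by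
  refine bar_map_lift_hom_ext fun P a n x t ↦ ?_
  have e : (power.lift fun i ↦ lift (G.map a) (mapPower G x ≫ power.π ((mapAb G).obj M).X i) ≫ p) =
      mapPower G (power.lift fun i ↦ lift a (x ≫ power.π M.X i) ≫ q) := by
    refine power.hom_ext fun i ↦ ?_
    rw [power.lift_π, mapPower_π, mapPower_π, power.lift_π, hp]
    exact (Functor.Monoidal.lift_μ_assoc G _ _ _).trans (G.map_comp _ _).symm
  rw [← Category.assoc, h', e, Category.assoc, barι_barComparison, lift_whiskerLeft_assoc,
    Category.assoc, barι_barComparison, Functor.Monoidal.lift_μ_assoc, ← Functor.map_comp, h]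

end BaseChange

/-! ### Base change of the multiplications -/

section BaseChangeProduct

variable {C : Type u} [Category.{v} C] [CartesianMonoidalCategory C] [BraidedCategory C]
  [MonoidalClosed C] [HasColimits C]
  {D : Type u'} [Category.{v} D] [CartesianMonoidalCategory D] [BraidedCategory D]
  [MonoidalClosed D] [HasColimits D]
  {F : SSet.{v} ⥤ C} [F.Braided] [F.IsLeftAdjoint] {G : C ⥤ D} [G.Braided] [G.IsLeftAdjoint]

lemma IsAdditiveRight.map {A : C} {M N : AbObj C} {q : A ⊗ M.X ⟶ N.X} (hq : IsAdditiveRight q) :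
    IsAdditiveRight (M := ((mapAb G).obj M).X) (N := ((mapAb G).obj N).X)
      (Functor.LaxMonoidal.μ G A M.X ≫ G.map q) :=
  isAdditiveRight_iff.2 (map_left_distrib G q (isAdditiveRight_iff.1 hq))

/-- If two pairings correspond to each other under `k`, `a`, `m`, then so do their extensions.
This factors through the pairing `G A × G M ⟶ G N` induced by `q`. -/
lemma ExtendsRight.baseChange {A : C} {M N : AbObj C} {q : A ⊗ M.X ⟶ N.X}
    {q' : A ⊗ ((bar F).obj M).X ⟶ ((bar F).obj N).X} (h : ExtendsRight F q q')
    (hq : IsAdditiveRight q) {A' : D} {M' N' : AbObj D} {p : A' ⊗ M'.X ⟶ N'.X}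
    {p' : A' ⊗ ((bar (F ⋙ G)).obj M').X ⟶ ((bar (F ⋙ G)).obj N').X}
    (h' : ExtendsRight (F ⋙ G) p p') {a : A' ⟶ G.obj A} {m : M' ⟶ (mapAb G).obj M}
    {k : N' ⟶ (mapAb G).obj N}
    (hp : p ≫ k.hom = (a ⊗ₘ m.hom) ≫ Functor.LaxMonoidal.μ G A M.X ≫ G.map q) :
    p' ≫ ((bar (F ⋙ G)).map k ≫ (barComparisonAb G F N).hom).hom =
      (a ⊗ₘ ((bar (F ⋙ G)).map m ≫ (barComparisonAb G F M).hom).hom) ≫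
        Functor.LaxMonoidal.μ G A ((bar F).obj M).X ≫ G.map q' := by
  obtain ⟨r, hr⟩ := exists_extendsRight (F := F ⋙ G) (hq.map (G := G))
  have e₁ := h'.naturality hr hp
  have e₂ := h.comp_barComparison hr rfl
  have e₃ : (a ⊗ₘ ((bar (F ⋙ G)).map m ≫ (barComparisonAb G F M).hom).hom) =
      (a ⊗ₘ ((bar (F ⋙ G)).map m).hom) ≫ G.obj A ◁ (barComparison G F M).hom := by
    rw [← id_tensorHom, tensorHom_comp_tensorHom, Category.comp_id]
    rfl
  have e₄ : p' ≫ ((bar (F ⋙ G)).map k).hom ≫ (barComparison G F N).hom =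
      (a ⊗ₘ ((bar (F ⋙ G)).map m).hom) ≫ G.obj A ◁ (barComparison G F M).hom ≫
        Functor.LaxMonoidal.μ G A ((bar F).obj M).X ≫ G.map q' := by
    rw [← e₂, reassoc_of% e₁]
  exact e₄.trans ((Category.assoc _ _ _).symm.trans (e₃.symm =≫ _))

/-- Compatibility of a pairing in `D` with one in `C`, rewritten with the factors swapped. -/
lemma comp_eq_map_iff_braiding {U V W : D} {X Y Z : C} (u : U ⟶ G.obj X) (v : V ⟶ G.obj Y)
    (p : U ⊗ V ⟶ W) (k : W ⟶ G.obj Z) (q : X ⊗ Y ⟶ Z) :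
    p ≫ k = (u ⊗ₘ v) ≫ Functor.LaxMonoidal.μ G X Y ≫ G.map q ↔
      ((β_ V U).hom ≫ p) ≫ k =
        (v ⊗ₘ u) ≫ Functor.LaxMonoidal.μ G Y X ≫ G.map ((β_ Y X).hom ≫ q) := by
  rw [Functor.map_comp, Functor.LaxBraided.braided_assoc,
    BraidedCategory.braiding_naturality_assoc, Category.assoc, cancel_epi]

lemma ExtendsLeft.baseChange {A : C} {M N : AbObj C} {q : M.X ⊗ A ⟶ N.X}
    {q' : ((bar F).obj M).X ⊗ A ⟶ ((bar F).obj N).X} (h : ExtendsLeft F q q')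
    (hq : IsAdditiveLeft q) {A' : D} {M' N' : AbObj D} {p : M'.X ⊗ A' ⟶ N'.X}
    {p' : ((bar (F ⋙ G)).obj M').X ⊗ A' ⟶ ((bar (F ⋙ G)).obj N').X}
    (h' : ExtendsLeft (F ⋙ G) p p') {a : A' ⟶ G.obj A} {m : M' ⟶ (mapAb G).obj M}
    {k : N' ⟶ (mapAb G).obj N}
    (hp : p ≫ k.hom = (m.hom ⊗ₘ a) ≫ Functor.LaxMonoidal.μ G M.X A ≫ G.map q) :
    p' ≫ ((bar (F ⋙ G)).map k ≫ (barComparisonAb G F N).hom).hom =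
      (((bar (F ⋙ G)).map m ≫ (barComparisonAb G F M).hom).hom ⊗ₘ a) ≫
        Functor.LaxMonoidal.μ G ((bar F).obj M).X A ≫ G.map q' := by
  exact (comp_eq_map_iff_braiding _ _ _ _ _).2 <|
    (extendsLeft_iff.1 h).baseChange (isAdditiveLeft_iff_braiding.1 hq) (extendsLeft_iff.1 h')
      (a := a) (m := m) (k := k) ((comp_eq_map_iff_braiding _ _ _ _ _).1 hp)

variable (F G) in
/-- The isomorphism `B^n (G M) ≅ G (B^n M)`. -/
def barIterComparison : ∀ (n : ℕ) (M : AbObj C),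
    (barIter (F ⋙ G) n).obj ((mapAb G).obj M) ≅ (mapAb G).obj ((barIter F n).obj M)
  | 0, _ => Iso.refl _
  | n + 1, M => (bar (F ⋙ G)).mapIso (barIterComparison n M) ≪≫
      barComparisonAb G F ((barIter F n).obj M)

lemma barIterComparison_naturality (n : ℕ) {M N : AbObj C} (f : M ⟶ N) :
    (barIter (F ⋙ G) n).map ((mapAb G).map f) ≫ (barIterComparison F G n N).hom =
      (barIterComparison F G n M).hom ≫ (mapAb G).map ((barIter F n).map f) := by
  induction n with
  | zero => exact (Category.comp_id _).trans (Category.id_comp _).symm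
  | succ n ih =>
    have e : (bar (F ⋙ G)).map ((mapAb G).map ((barIter F n).map f)) ≫
        (barComparisonAb G F _).hom =
          (barComparisonAb G F _).hom ≫ (mapAb G).map ((bar F).map ((barIter F n).map f)) :=
      AbObj.hom_ext (barComparison_naturality _)
    change (bar (F ⋙ G)).map _ ≫ (bar (F ⋙ G)).map _ ≫ _ = ((bar (F ⋙ G)).map _ ≫ _) ≫ _
    rw [← Functor.map_comp_assoc, ih, Functor.map_comp_assoc, Category.assoc]
    exact _ ≫= e

/-- The comparison isomorphisms respect the multiplications. -/
lemma barIterComparison_mul {S : RingObjCat C}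
    {R : GrRingStr ((barGraded F).obj (ringToAb.obj S))} (hR : IsBarMultiplication F S R)
    {Q : GrRingStr ((barGraded (F ⋙ G)).obj (ringToAb.obj ((mapRing G).obj S)))}
    (hQ : IsBarMultiplication (F ⋙ G) ((mapRing G).obj S) Q) (n m k : ℕ) (h : n + m = k) :
    Q.mul n m k h ≫ (barIterComparison F G k (ringToAb.obj S)).hom.hom =
      ((barIterComparison F G n (ringToAb.obj S)).hom.hom ⊗ₘ
        (barIterComparison F G m (ringToAb.obj S)).hom.hom) ≫
          Functor.LaxMonoidal.μ G _ _ ≫ G.map (R.mul n m k h) := by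
  induction n generalizing k with
  | succ n ih =>
    obtain ⟨k, rfl⟩ : ∃ j, k = j + 1 := ⟨n + m, by omega⟩
    exact (hR.isBarProduct.succ n m k (by omega)).baseChange
      (isAdditiveLeft_iff.2 (R.add_mul n m k (by omega)))
      (hQ.isBarProduct.succ n m k (by omega)) (ih k (by omega))
  | zero =>
    obtain rfl : m = k := by omega
    induction m with
    | succ m ih =>
      exact (hR.isBarProduct.zero_succ m).baseChange
        (isAdditiveRight_iff.2 (R.mul_add 0 m m (by omega)))
        (hQ.isBarProduct.zero_succ m) (ih (by omega))
    | zero =>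
      have e : Q.mul 0 0 0 h = Functor.LaxMonoidal.μ G S.X S.X ≫ G.map (R.mul 0 0 0 h) :=
        hQ.mul_zero_zero.trans
          (congr_arg (fun z ↦ Functor.LaxMonoidal.μ G S.X S.X ≫ G.map z) hR.mul_zero_zero).symm
      have e' : Functor.LaxMonoidal.μ G S.X S.X ≫ G.map (R.mul 0 0 0 h) =
          (𝟙 (G.obj S.X) ⊗ₘ 𝟙 (G.obj S.X)) ≫
            Functor.LaxMonoidal.μ G S.X S.X ≫ G.map (R.mul 0 0 0 h) := by
        rw [id_tensorHom_id, Category.id_comp]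
      exact (Category.comp_id _).trans (e.trans e')

lemma isGrRingHom_barIterComparison {S : RingObjCat C}
    {R : GrRingStr ((barGraded F).obj (ringToAb.obj S))} (hR : IsBarMultiplication F S R)
    {Q : GrRingStr ((barGraded (F ⋙ G)).obj (ringToAb.obj ((mapRing G).obj S)))}
    (hQ : IsBarMultiplication (F ⋙ G) ((mapRing G).obj S) Q) :
    IsGrRingHom Q (R.map G) (fun n ↦ (barIterComparison F G n (ringToAb.obj S)).hom) where
  map_one := (Category.comp_id _).trans (hQ.one.trans
    (congr_arg (fun z ↦ Functor.LaxMonoidal.ε G ≫ G.map z) hR.one).symm)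
  map_mul := barIterComparison_mul hR hQ

/-- A degreewise isomorphism that is a morphism of graded rings is an isomorphism of graded
rings. -/
def GrRing.isoOfIsGrRingHom {R S : GrRing D} (e : ∀ n, R.A n ≅ S.A n)
    (h : IsGrRingHom R.str S.str fun n ↦ (e n).hom) : R ≅ S where
  hom := ⟨fun n ↦ (e n).hom, h⟩
  inv := ⟨fun n ↦ (e n).inv,
    { map_one := by
        have e₀ : (e 0).hom.hom ≫ (e 0).inv.hom = 𝟙 _ :=
          congr_arg AbObj.Hom.hom (e 0).hom_inv_id
        rw [← h.map_one, Category.assoc, e₀, Category.comp_id]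
      map_mul n m k hk := by
        have e₁ (j : ℕ) : (e j).hom.hom ≫ (e j).inv.hom = 𝟙 _ :=
          congr_arg AbObj.Hom.hom (e j).hom_inv_id
        have e₂ (j : ℕ) : (e j).inv.hom ≫ (e j).hom.hom = 𝟙 _ :=
          congr_arg AbObj.Hom.hom (e j).inv_hom_id
        have e₃ : S.str.mul n m k hk = ((e n).inv.hom ⊗ₘ (e m).inv.hom) ≫
            R.str.mul n m k hk ≫ (e k).hom.hom := by
          rw [h.map_mul, tensorHom_comp_tensorHom_assoc, e₂, e₂, id_tensorHom_id,
            Category.id_comp]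
        rw [e₃, Category.assoc, Category.assoc, e₁, Category.comp_id] }⟩
  hom_inv_id := GrRing.hom_ext (funext fun n ↦ (e n).hom_inv_id)
  inv_hom_id := GrRing.hom_ext (funext fun n ↦ (e n).inv_hom_id)

/-- The natural isomorphism `B^* ∘ G ≅ G ∘ B^*`. -/
def barGrRingComparison
    (Φ : GrRingLift (ringToAb (C := C) ⋙ barGraded F))
    (Ψ : GrRingLift (ringToAb (C := D) ⋙ barGraded (F ⋙ G)))
    (hΦ : ∀ S : RingObjCat C, IsBarMultiplication F S (Φ.str S))
    (hΨ : ∀ S : RingObjCat D, IsBarMultiplication (F ⋙ G) S (Ψ.str S)) :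
    mapRing G ⋙ Ψ.toFunctor ≅ Φ.toFunctor ⋙ mapGrRing G :=
  NatIso.ofComponents (fun S ↦ GrRing.isoOfIsGrRingHom
      (R := (mapRing G ⋙ Ψ.toFunctor).obj S) (S := (Φ.toFunctor ⋙ mapGrRing G).obj S)
      (fun n ↦ barIterComparison F G n (ringToAb.obj S))
      (isGrRingHom_barIterComparison (hΦ S) (hΨ ((mapRing G).obj S))))
    (fun f ↦ GrRing.hom_ext (funext fun n ↦ barIterComparison_naturality n (ringToAb.map f)))

end BaseChangeProduct

end BarConstruction

theorem theorem3p2 {C : Type u} [Category.{v} C] [CartesianMonoidalCategory C]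
    [BraidedCategory C] [MonoidalClosed C] [HasColimits C]
    (F : SSet.{v} ⥤ C) [F.Braided] [F.IsLeftAdjoint] :
    (∃ Φ : BarConstruction.GrRingLift
        (BarConstruction.ringToAb (C := C) ⋙ BarConstruction.barGraded F),
      ∀ S : RingObjCat C, BarConstruction.IsBarMultiplication F S (Φ.str S)) ∧
    ∀ {D : Type u'} [Category.{v} D] [CartesianMonoidalCategory D]
      [BraidedCategory D] [MonoidalClosed D] [HasColimits D]
      (G : C ⥤ D) [G.Braided] [G.IsLeftAdjoint]
      (Φ : BarConstruction.GrRingLift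
        (BarConstruction.ringToAb (C := C) ⋙ BarConstruction.barGraded F))
      (Ψ : BarConstruction.GrRingLift
        (BarConstruction.ringToAb (C := D) ⋙ BarConstruction.barGraded (F ⋙ G))),
      (∀ S : RingObjCat C, BarConstruction.IsBarMultiplication F S (Φ.str S)) →
      (∀ S : RingObjCat D, BarConstruction.IsBarMultiplication (F ⋙ G) S (Ψ.str S)) →
      Nonempty (BarConstruction.mapRing G ⋙ Ψ.toFunctor ≅
        Φ.toFunctor ⋙ BarConstruction.mapGrRing G) := by
  exact ⟨⟨BarConstruction.barGrRingLift F, BarConstruction.isBarMultiplication_barGrRingStr F⟩,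
    fun G _ _ Φ Ψ hΦ hΨ ↦ ⟨BarConstruction.barGrRingComparison Φ Ψ hΦ hΨ⟩⟩
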